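/- **Spinning conical defect: the condition $u\le d$ coincides with holographic scattering.** Let $-1<M<0$ and $|J|\le 1-|M|$, $|J|<|M|$, and put $$b_\pm=\tfrac12\left(\sqrt{|M|+J}\pm\sqrt{|M|-J}\right),\qquad\text{so that } |M|=b_+^2+b_-^2,\quad J=2b_+b_- .$$ Consider the spinning defect metric $$ds^2=-(r^2-M)\,dt^2+\frac{dr^2}{r^2-M+\frac{J^2}{4r^2}}+r^2\,d\phi^2-J\,dt\,d\phi,$$ on the whole region $r^2>-b_-^2$ outside the defect (with $r^2$ as a coordinate, so that $r^2\le 0$ is allowed), time-oriented by $\partial_t$, and with the angle $\phi$ unwrapped ($\phi\in\mathbb R$). The conformal boundary $r\to\infty$ has coordinates $(t,\phi)$. Let $0<x<\theta<\pi$, and let $V_1,V_2$ be the boundary intervals of width $x$ on the slice $t=(\theta-x)/2$ centred at $\phi=-\theta/2$ and $\phi=\theta/2$. The past-most points of their causal developments (for the boundary metric $-dt^2+d\phi^2$) are $c_{1}=(\theta/2-x,-\theta/2)$ and $c_2=(\theta/2-x,\theta/2)$, and the future-most points are $b_1=(\theta/2,-\theta/2)$ and $b_2=(\theta/2,\theta/2)$.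 Consider the inequality $$\frac{\sin^2\left(\frac{b_+-b_-}{2}x\right)}{\sin^2\left(\frac{b_+-b_-}{2}\theta\right)}+\frac{\sin^2\left(\frac{b_++b_-}{2}x\right)}{\sin^2\left(\frac{b_++b_-}{2}\theta\right)}\ \ge\ 1 .\qquad (*)$$ 1. *Extremal surfaces.* Suppose $\theta+x<\pi/b_+$. Then the outermost endpoints of $V_1,V_2$ (separation $\theta+x$), their innermost endpoints (separation $\theta-x$), and the two endpoints of each $V_i$ (separation $x$) are joined by complete spacelike geodesics. The renormalized length of such a geodesic (the limit as $\epsilon\to0$ of its length inside $r\le 1/\epsilon$ minus $2\log(1/\epsilon)$) exists and depends only on the endpoints. Let $u$ be the sum of the renormalized lengths for the outermost and the innermost pair, and let $d$ be the sum of those for $V_1$ and $V_2$. Then $u\le d$ if and only if $(*)$ holds. 2. *Scattering.* There is a complete spacelike geodesic $\gamma$ from $b_1$ to $b_2$, and for every such $\gamma$ the bulk scattering region $$\mathcal J^+(c_1)\cap\mathcal J^+(c_2)\cap\mathcal J^-(\gamma)$$ is non-empty if and only if $(*)$ holds. Here $\mathcal J^+(c_i)$ is the set of bulk points that are reached by a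 future-directed causal curve in the bulk starting at the boundary point $c_i$, and $\mathcal J^-(\gamma)$ is the causal past of $\gamma$. In particular, when $\theta+x<\pi/b_+$, one has $u\le d$ if and only if the scattering region is non-empty. -/

import Mathlib

open Filter Topology MeasureTheory

noncomputable section

namespace SpinningDefect

/-- `b₊ = (√(|M|+J) + √(|M|-J)) / 2`. -/
def bPlus (M J : ℝ) : ℝ := (Real.sqrt (|M| + J) + Real.sqrt (|M| - J)) / 2

/-- `b₋ = (√(|M|+J) - √(|M|-J)) / 2`. -/
def bMinus (M J : ℝ) : ℝ := (Real.sqrt (|M| + J) - Real.sqrt (|M| - J)) / 2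

/-! ### The geometry -/

/-- A bulk event, in the coordinates `(x 0, x 1, x 2) = (t, r², φ)`. The angle is unwrapped, that
is, `φ` runs over `ℝ`: a curve here is the lift of a curve of the defect spacetime, and the homotopy
class of a curve relative to the defect is encoded in the `φ`-coordinates of its endpoints. Using
`r²` instead of `r` allows the region `r² < 0` beyond `r = 0`. -/
abbrev Event := Fin 3 → ℝ

/-- A point `(t, φ)` of the conformal boundary (with `φ` unwrapped). -/
abbrev BdyPoint := ℝ × ℝ

/-- The bulk: everything outside the defect, which sits at `r² = -b₋²`. -/
def bulk (M J : ℝ) : Set Event := {x | -(bMinus M J) ^ 2 < x 1}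

/-- The spinning defect metric
`-(r² - M) dt² + dr² / (r² - M + J² / (4 r²)) + r² dφ² - J dt dφ`
in the coordinates `(t, w = r², φ)`: since `dw = 2 r dr`, the second term is
`dw² / (4 (w² - M w + J² / 4))`. -/
def metric (M J : ℝ) (x : Event) : Matrix (Fin 3) (Fin 3) ℝ :=
  !![-(x 1 - M), 0, -J / 2;
     0, 1 / (4 * ((x 1) ^ 2 - M * x 1 + J ^ 2 / 4)), 0;
     -J / 2, 0, x 1]

/-- The inner product of the tangent vectors `v` and `v'` at `x`. -/
def metricInner (M J : ℝ) (x v v' : Event) : ℝ :=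
  ∑ i, ∑ j, metric M J x i j * v i * v' j

/-- The bulk curve `c` tends, along the filter `l` of parameter values, to the point `P` of the
conformal boundary. -/
def TendsToBdy (c : ℝ → Event) (l : Filter ℝ) (P : BdyPoint) : Prop :=
  Tendsto (fun s => c s 0) l (𝓝 P.1) ∧ Tendsto (fun s => c s 1) l atTop ∧
    Tendsto (fun s => c s 2) l (𝓝 P.2)

/-! ### Extremal curves and their lengths -/

/-- `γ` is a spacelike geodesic of the bulk, parametrized by arclength, so that it satisfies
`d/ds (g_{ij} γ̇^j) = ½ (∂_i g_{jk}) γ̇^j γ̇^k`. -/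
def IsSpacelikeGeodesic (M J : ℝ) (γ : ℝ → Event) : Prop :=
  ContDiff ℝ 2 γ ∧ (∀ s, γ s ∈ bulk M J) ∧
  (∀ s, metricInner M J (γ s) (deriv γ s) (deriv γ s) = 1) ∧
  ∀ s, ∀ i : Fin 3,
    HasDerivAt (fun σ => ∑ j, metric M J (γ σ) i j * deriv γ σ j)
      ((1 / 2) * ∑ j, ∑ k,
        fderiv ℝ (fun x : Event => metric M J x j k) (γ s) (Pi.single i 1)
          * deriv γ s j * deriv γ s k) s

/-- `γ` is a complete spacelike geodesic of the bulk that runs from the boundary point `P` to the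
boundary point `Q`. -/
def IsExtremalCurve (M J : ℝ) (P Q : BdyPoint) (γ : ℝ → Event) : Prop :=
  IsSpacelikeGeodesic M J γ ∧ TendsToBdy γ atBot P ∧ TendsToBdy γ atTop Q

/-- The length of the part of `γ` inside the cutoff surface `r = 1 / ε`. -/
def cutoffLength (M J : ℝ) (γ : ℝ → Event) (ε : ℝ) : ℝ :=
  ∫ s in {s : ℝ | γ s 1 ≤ (1 / ε) ^ 2},
    Real.sqrt (metricInner M J (γ s) (deriv γ s) (deriv γ s))

/-- `ℓ` is the renormalized length of `γ`: the length inside the cutoff surface `r = 1 / ε` is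
`2 log (1 / ε) + ℓ + o(1)` as `ε → 0`. -/
def HasRenLength (M J : ℝ) (γ : ℝ → Event) (ℓ : ℝ) : Prop :=
  Tendsto (fun ε => cutoffLength M J γ ε - 2 * Real.log (1 / ε)) (𝓝[>] 0) (𝓝 ℓ)

/-- `P` and `Q` are joined by an extremal curve, and `ℓ` is the renormalized length of every
extremal curve that joins them. -/
def IsExtremalLength (M J : ℝ) (P Q : BdyPoint) (ℓ : ℝ) : Prop :=
  (∃ γ, IsExtremalCurve M J P Q γ) ∧ ∀ γ, IsExtremalCurve M J P Q γ → HasRenLength M J γ ℓ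

/-! ### Causal structure and bulk scattering -/

/-- The tangent vector `v` at `x` is causal and future directed. The time orientation is given by
the vector field `∂_t`, which is timelike in the whole bulk. -/
def IsFutureCausal (M J : ℝ) (x v : Event) : Prop :=
  metricInner M J x v v ≤ 0 ∧ metricInner M J x v (Pi.single 0 1) < 0

/-- `c` is, on the interval `I`, a continuous curve in the bulk that is differentiable with causal
future directed velocity except at finitely many corners. -/
def IsFutureCausalCurve (M J : ℝ) (c : ℝ → Event) (I : Set ℝ) : Prop :=
  ContinuousOn c I ∧ (∀ s ∈ I, c s ∈ bulk M J) ∧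
  ∃ F : Finset ℝ, ∀ s ∈ interior I, s ∉ F →
    ∃ v, HasDerivAt c v s ∧ IsFutureCausal M J (c s) v

/-- `𝒥⁺(P)`: the bulk points in the causal future of the boundary point `P`. -/
def causalFuture (M J : ℝ) (P : BdyPoint) : Set Event :=
  {p | ∃ c : ℝ → Event, IsFutureCausalCurve M J c (Set.Ioc 0 1) ∧
    TendsToBdy c (𝓝[>] 0) P ∧ c 1 = p}

/-- `𝒥⁻(S)`: the bulk points in the causal past of the set `S` of bulk points. -/
def causalPast (M J : ℝ) (S : Set Event) : Set Event :=
  {p | p ∈ bulk M J ∧ ∃ q ∈ S, p = q ∨ ∃ c : ℝ → Event,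
    IsFutureCausalCurve M J c (Set.Icc 0 1) ∧ c 0 = p ∧ c 1 = q}

/-- The bulk scattering region `𝒥⁺(c₁) ∩ 𝒥⁺(c₂) ∩ 𝒥⁻(γ)`. -/
def scatteringRegion (M J : ℝ) (c₁ c₂ : BdyPoint) (γ : ℝ → Event) : Set Event :=
  causalFuture M J c₁ ∩ causalFuture M J c₂ ∩ causalPast M J (Set.range γ)

/-! ### The input regions -/

/-- An interval of width `width`, centred at the angle `mid`, on the time slice `t = time` of the
boundary. -/
structure BdyInterval where
  time : ℝ
  mid : ℝ
  width : ℝ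

namespace BdyInterval

/-- The left endpoint. -/
def left (A : BdyInterval) : BdyPoint := (A.time, A.mid - A.width / 2)

/-- The right endpoint. -/
def right (A : BdyInterval) : BdyPoint := (A.time, A.mid + A.width / 2)

/-- The past-most point of the causal development of the interval, for the boundary metric
`-dt² + dφ²`. -/
def pastTip (A : BdyInterval) : BdyPoint := (A.time - A.width / 2, A.mid)

/-- The future-most point of the causal development of the interval. -/
def futureTip (A : BdyInterval) : BdyPoint := (A.time + A.width / 2, A.mid)

end BdyInterval

/-- The first input region: width `x`, centred at `φ = -θ / 2`. The time slice is the one for which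
the past-most point of the output region between the two inputs is `(t, φ) = (0, 0)`. -/
def inputOne (θ x : ℝ) : BdyInterval := ⟨(θ - x) / 2, -θ / 2, x⟩

/-- The second input region: width `x`, centred at `φ = θ / 2`, on the same time slice. -/
def inputTwo (θ x : ℝ) : BdyInterval := ⟨(θ - x) / 2, θ / 2, x⟩

/-- The inequality
`sin²((b₊-b₋)x/2) / sin²((b₊-b₋)θ/2) + sin²((b₊+b₋)x/2) / sin²((b₊+b₋)θ/2) ≥ 1`. -/
def SineCondition (M J θ x : ℝ) : Prop :=
  Real.sin ((bPlus M J - bMinus M J) / 2 * x) ^ 2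
      / Real.sin ((bPlus M J - bMinus M J) / 2 * θ) ^ 2
    + Real.sin ((bPlus M J + bMinus M J) / 2 * x) ^ 2
      / Real.sin ((bPlus M J + bMinus M J) / 2 * θ) ^ 2 ≥ 1

end SpinningDefect

end

/-! Write `T = b₊ t + b₋ φ`, `Φ = b₊ φ + b₋ t`, `u = r² + b₋²`, `U = r² + b₊²` and `K = b₊² - b₋² =
U - u`. The metric times `K` is `-U dT² + u dΦ² + K dw² / (4 u U)` with `w = r²`, so locally the
defect is anti-de Sitter space, with embedding coordinates `√U (cos T, sin T)` and `√u (cos Φ, sin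
Φ)` up to the factor `√K`. A boundary point `P` corresponds to the null vector `N(P) = (cos T, sin
T; cos Φ, sin Φ)`.

Along a unit-speed spacelike geodesic every embedding coordinate satisfies `f'' = f`, so a complete
geodesic from `P` to `Q` is `a eˢ N(Q) + b e⁻ˢ N(P)`, and `U - u = K` forces `2ab (cos ΔT - cos ΔΦ)
= K` (`IsExtremalCurve.embedding`). The cutoff condition on `r²` is then a bound on a `cosh`, which
gives the renormalized length `-log (ab)`, a function of the endpoints only. At equal times and
separation `δ`, `cos ΔT - cos ΔΦ` is `2 sin((b₊+b₋)δ/2) sin((b₊-b₋)δ/2)`. So `u ≤ d` says that the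
product of these sines at `θ + x` and `θ - x` is at most the square of their value at `x`. By
`sin(α+β) sin(α-β) = sin²α - sin²β` this is the sine condition (`sineCondition_iff`).

For scattering, a future-directed curve leaving the past of `γ` ends on `γ`, so only points of `γ`
matter. In the ranges that occur, a point with `T ≥ T(c)` lies in the future of the boundary point
`c` exactly when `√U cos(T - T(c)) ≤ √u cos(Φ - Φ(c))`. Necessity is a monotone quantity along
causal curves (`hasDerivAt_time_sub_arccos`); sufficiency is an explicit curve
(`mem_causalFuture_of_le`). This inequality is linear in the embedding coordinates. Along `γ` the
conditions for `c₁` and `c₂` therefore become `a eˢ q₁ ≤ b e⁻ˢ n` and `b e⁻ˢ q₂ ≤ a eˢ n`, which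
have a common solution `s` iff `q₁ q₂ ≤ n²`. The four sines in `q₁ q₂` are those of the outermost
and innermost lengths, grouped differently, so this is the same inequality (`scattering_iff`). -/

noncomputable section

namespace SpinningDefect

/-! ### Global coordinates -/

/-- The global time `b₊ t + b₋ φ` of the locally isometric anti-de Sitter space. -/
def globalTime (M J t φ : ℝ) : ℝ := bPlus M J * t + bMinus M J * φ

/-- The global angle `b₊ φ + b₋ t` of the locally isometric anti-de Sitter space. -/
def globalAngle (M J t φ : ℝ) : ℝ := bPlus M J * φ + bMinus M J * t

/-- `b₊² - b₋²`. -/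
def gap (M J : ℝ) : ℝ := bPlus M J ^ 2 - bMinus M J ^ 2

variable {M J : ℝ}

lemma sq_bPlus_add_sq_bMinus (hJ : |J| < |M|) : bPlus M J ^ 2 + bMinus M J ^ 2 = |M| := by
  obtain ⟨h1, h2⟩ := abs_lt.1 hJ
  have a := Real.sq_sqrt (show 0 ≤ |M| + J by linarith)
  have b := Real.sq_sqrt (show 0 ≤ |M| - J by linarith)
  unfold bPlus bMinus
  linear_combination (1 / 2) * a + (1 / 2) * b

lemma two_mul_bPlus_mul_bMinus (hJ : |J| < |M|) : 2 * bPlus M J * bMinus M J = J := by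
  obtain ⟨h1, h2⟩ := abs_lt.1 hJ
  have a := Real.sq_sqrt (show 0 ≤ |M| + J by linarith)
  have b := Real.sq_sqrt (show 0 ≤ |M| - J by linarith)
  unfold bPlus bMinus
  linear_combination (1 / 2) * a - (1 / 2) * b

lemma bPlus_add_bMinus_pos (hJ : |J| < |M|) : 0 < bPlus M J + bMinus M J := by
  obtain ⟨h1, h2⟩ := abs_lt.1 hJ
  have a := Real.sqrt_pos.2 (show 0 < |M| + J by linarith)
  unfold bPlus bMinus
  linarith

lemma bPlus_sub_bMinus_pos (hJ : |J| < |M|) : 0 < bPlus M J - bMinus M J := by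
  obtain ⟨h1, h2⟩ := abs_lt.1 hJ
  have a := Real.sqrt_pos.2 (show 0 < |M| - J by linarith)
  unfold bPlus bMinus
  linarith

lemma bPlus_pos (hJ : |J| < |M|) : 0 < bPlus M J := by
  linarith [bPlus_add_bMinus_pos hJ, bPlus_sub_bMinus_pos hJ]

lemma gap_pos (hJ : |J| < |M|) : 0 < gap M J := by
  have := mul_pos (bPlus_add_bMinus_pos hJ) (bPlus_sub_bMinus_pos hJ)
  unfold gap
  linarith

/-- Since `(b₊ ± b₋)² = |M| ± J`, this bound and the next are what `|J| ≤ 1 - |M|` provides. They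
keep the arguments of the sines in `(0, π)` and the global coordinate differences within `π`. -/
lemma bPlus_add_bMinus_le_one (hJ : |J| < |M|) (hJ1 : |J| ≤ 1 - |M|) :
    bPlus M J + bMinus M J ≤ 1 := by
  have := sq_bPlus_add_sq_bMinus hJ
  have := two_mul_bPlus_mul_bMinus hJ
  have := le_abs_self J
  nlinarith [bPlus_add_bMinus_pos hJ]

lemma bPlus_sub_bMinus_le_one (hJ : |J| < |M|) (hJ1 : |J| ≤ 1 - |M|) :
    bPlus M J - bMinus M J ≤ 1 := by
  have := sq_bPlus_add_sq_bMinus hJ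
  have := two_mul_bPlus_mul_bMinus hJ
  have := neg_abs_le J
  nlinarith [bPlus_sub_bMinus_pos hJ]

lemma time_eq_of_global (hJ : |J| < |M|) (t φ : ℝ) :
    t = (bPlus M J * globalTime M J t φ - bMinus M J * globalAngle M J t φ) / gap M J := by
  rw [eq_div_iff (gap_pos hJ).ne']
  unfold globalTime globalAngle gap
  ring

lemma angle_eq_of_global (hJ : |J| < |M|) (t φ : ℝ) :
    φ = (bPlus M J * globalAngle M J t φ - bMinus M J * globalTime M J t φ) / gap M J := by
  rw [eq_div_iff (gap_pos hJ).ne']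
  unfold globalTime globalAngle gap
  ring

lemma globalTime_div_gap (hJ : |J| < |M|) (T A : ℝ) :
    globalTime M J ((bPlus M J * T - bMinus M J * A) / gap M J)
      ((bPlus M J * A - bMinus M J * T) / gap M J) = T := by
  have h := (gap_pos hJ).ne'
  unfold globalTime
  field_simp
  unfold gap
  ring

lemma globalAngle_div_gap (hJ : |J| < |M|) (T A : ℝ) :
    globalAngle M J ((bPlus M J * T - bMinus M J * A) / gap M J)
      ((bPlus M J * A - bMinus M J * T) / gap M J) = A := by
  have h := (gap_pos hJ).ne'
  unfold globalAngle
  field_simp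
  unfold gap
  ring

lemma radial_factor (hM0 : M < 0) (hJ : |J| < |M|) (w : ℝ) :
    w ^ 2 - M * w + J ^ 2 / 4 = (w + bMinus M J ^ 2) * (w + bPlus M J ^ 2) := by
  have h1 := sq_bPlus_add_sq_bMinus hJ
  have h2 := two_mul_bPlus_mul_bMinus hJ
  rw [abs_of_neg hM0] at h1
  have h3 : J ^ 2 / 4 = bPlus M J ^ 2 * bMinus M J ^ 2 := by
    linear_combination (-(2 * bPlus M J * bMinus M J + J) / 4) * h2
  linear_combination (-w) * h1 + h3

lemma inner_pos {x : Event} (hx : x ∈ bulk M J) : 0 < x 1 + bMinus M J ^ 2 := by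
  have : -(bMinus M J) ^ 2 < x 1 := hx
  linarith

lemma outer_eq (x : Event) : x 1 + bPlus M J ^ 2 = x 1 + bMinus M J ^ 2 + gap M J := by
  unfold gap; ring

lemma outer_pos (hJ : |J| < |M|) {x : Event} (hx : x ∈ bulk M J) : 0 < x 1 + bPlus M J ^ 2 := by
  rw [outer_eq]
  linarith [inner_pos hx, gap_pos hJ]

/-- The global coordinates diagonalize the metric. All later computations of geodesics and causality
use this form; the factor `gap M J` comes from inverting the linear change of coordinates. -/
lemma gap_mul_metricInner (hM0 : M < 0) (hJ : |J| < |M|) (x v v' : Event) :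
    gap M J * metricInner M J x v v' =
      -(x 1 + bPlus M J ^ 2) * globalTime M J (v 0) (v 2) * globalTime M J (v' 0) (v' 2)
      + (x 1 + bMinus M J ^ 2) * globalAngle M J (v 0) (v 2) * globalAngle M J (v' 0) (v' 2)
      + gap M J * v 1 * v' 1 / (4 * ((x 1 + bMinus M J ^ 2) * (x 1 + bPlus M J ^ 2))) := by
  have h1 := sq_bPlus_add_sq_bMinus hJ
  have h2 := two_mul_bPlus_mul_bMinus hJ
  rw [abs_of_neg hM0] at h1
  simp only [metricInner, metric, Fin.sum_univ_three, radial_factor hM0 hJ]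
  simp
  simp only [div_eq_mul_inv, mul_inv]
  unfold globalTime globalAngle gap
  set p := bPlus M J
  set q := bMinus M J
  linear_combination (p ^ 2 - q ^ 2) * v 0 * v' 0 * h1
    + (p ^ 2 - q ^ 2) * (v 0 * v' 2 + v 2 * v' 0) / 2 * h2

/-! ### The geodesic equation -/

lemma hasFDerivAt_coord (i : Fin 3) (x : Event) :
    HasFDerivAt (fun y : Event => y i) (ContinuousLinearMap.proj (R := ℝ) i) x :=
  (ContinuousLinearMap.proj (R := ℝ) (φ := fun _ : Fin 3 => ℝ) i).hasFDerivAt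

lemma half_sum_fderiv_metric (hM0 : M < 0) (hJ : |J| < |M|) {x : Event} (hx : x ∈ bulk M J)
    (v : Event) (i : Fin 3) :
    ((1 / 2) * ∑ j, ∑ k, fderiv ℝ (fun y : Event => metric M J y j k) x (Pi.single i 1)
      * v j * v k) =
    if i = 1 then (1 / 2) * (-v 0 ^ 2 + v 2 ^ 2
      - v 1 ^ 2 * (2 * x 1 + bMinus M J ^ 2 + bPlus M J ^ 2)
        / (4 * ((x 1 + bMinus M J ^ 2) * (x 1 + bPlus M J ^ 2)) ^ 2)) else 0 := by
  have hQ : (x 1 + bMinus M J ^ 2) * (x 1 + bPlus M J ^ 2) ≠ 0 :=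
    (mul_pos (inner_pos hx) (outer_pos hJ hx)).ne'
  have hc := hasFDerivAt_coord 1 x
  have e00 : fderiv ℝ (fun y : Event => metric M J y 0 0) x =
      -ContinuousLinearMap.proj (R := ℝ) 1 := by
    simpa [metric] using (hc.const_sub M).fderiv
  have e22 : fderiv ℝ (fun y : Event => metric M J y 2 2) x =
      ContinuousLinearMap.proj (R := ℝ) 1 := by
    simpa [metric] using hc.fderiv
  have e11 : fderiv ℝ (fun y : Event => metric M J y 1 1) x =
      (-(2 * x 1 + bMinus M J ^ 2 + bPlus M J ^ 2)
        / (4 * ((x 1 + bMinus M J ^ 2) * (x 1 + bPlus M J ^ 2)) ^ 2)) •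
      ContinuousLinearMap.proj (R := ℝ) 1 := by
    have hg : HasDerivAt (fun w : ℝ => 1 / (4 * ((w + bMinus M J ^ 2) * (w + bPlus M J ^ 2))))
        (-(2 * x 1 + bMinus M J ^ 2 + bPlus M J ^ 2)
          / (4 * ((x 1 + bMinus M J ^ 2) * (x 1 + bPlus M J ^ 2)) ^ 2)) (x 1) := by
      have h := ((((hasDerivAt_id' (x 1)).add_const (bMinus M J ^ 2)).fun_mul
        ((hasDerivAt_id' (x 1)).add_const (bPlus M J ^ 2))).const_mul 4).fun_inv
          (mul_ne_zero four_ne_zero hQ)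
      simp only [one_div]
      refine h.congr_deriv ?_
      have := (mul_ne_zero_iff.1 hQ).1
      have := (mul_ne_zero_iff.1 hQ).2
      field_simp
      ring
    have h := hg.comp_hasFDerivAt x hc
    have e : (fun y : Event => metric M J y 1 1) =
        (fun w : ℝ => 1 / (4 * ((w + bMinus M J ^ 2) * (w + bPlus M J ^ 2)))) ∘ fun y => y 1 := by
      ext y
      simp [metric, radial_factor hM0 hJ]
    rw [e]
    exact h.fderiv
  have e01 : ∀ j k : Fin 3, j ≠ k → fderiv ℝ (fun y : Event => metric M J y j k) x = 0 := by
    intro j k hjk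
    fin_cases j <;> fin_cases k <;> simp [metric] at hjk ⊢
  simp only [Fin.sum_univ_three, e00, e11, e22, e01 0 1 (by decide), e01 0 2 (by decide),
    e01 1 0 (by decide), e01 1 2 (by decide), e01 2 0 (by decide), e01 2 1 (by decide)]
  fin_cases i <;> simp
  ring

/-! ### Linear form of the geodesics -/

lemma eq_exp_add_exp_of_hasDerivAt {f g : ℝ → ℝ} (hf : ∀ s, HasDerivAt f (g s) s)
    (hg : ∀ s, HasDerivAt g (f s) s) :
    ∃ A B : ℝ, ∀ s, f s = A * Real.exp s + B * Real.exp (-s) := by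
  have h1 : ∀ s, HasDerivAt (fun s => (f s + g s) * Real.exp (-s)) 0 s := fun s =>
    (((hf s).fun_add (hg s)).fun_mul (hasDerivAt_neg' s).exp).congr_deriv (by ring)
  have h2 : ∀ s, HasDerivAt (fun s => (f s - g s) * Real.exp s) 0 s := fun s =>
    (((hf s).fun_sub (hg s)).fun_mul (Real.hasDerivAt_exp s)).congr_deriv (by ring)
  refine ⟨(f 0 + g 0) / 2, (f 0 - g 0) / 2, fun s => ?_⟩
  have e1 := is_const_of_deriv_eq_zero (fun s => (h1 s).differentiableAt) (fun s => (h1 s).deriv) s 0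
  have e2 := is_const_of_deriv_eq_zero (fun s => (h2 s).differentiableAt) (fun s => (h2 s).deriv) s 0
  simp only [neg_zero, Real.exp_zero, mul_one] at e1 e2
  have e3 : Real.exp (-s) * Real.exp s = 1 := by rw [← Real.exp_add]; simp
  rw [← e1, ← e2]
  linear_combination (-f s) * e3

/-- With `R = √U`, hypothesis `e1` is conservation of `R² τ'` and `e2` is `R'' = R (1 + τ'²)`. These
are polar coordinates for a planar vector with `f'' = f`, and `R cos(τ - c)` is its component in
direction `c`. -/
lemma hasDerivAt_sqrt_mul_cos {U U1 τ τ1 : ℝ → ℝ} {U2 τ2 s : ℝ} (c : ℝ)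
    (hU : ∀ s, HasDerivAt U (U1 s) s) (hU1 : HasDerivAt U1 U2 s)
    (hτ : ∀ s, HasDerivAt τ (τ1 s) s) (hτ1 : HasDerivAt τ1 τ2 s) (hpos : ∀ s, 0 < U s)
    (e1 : U1 s * τ1 s + U s * τ2 = 0)
    (e2 : U2 = U1 s ^ 2 / (2 * U s) + 2 * U s * (1 + τ1 s ^ 2)) :
    HasDerivAt (fun s => √(U s) * Real.cos (τ s - c))
      (U1 s / (2 * √(U s)) * Real.cos (τ s - c) - √(U s) * (Real.sin (τ s - c) * τ1 s)) s ∧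
    HasDerivAt (fun s => U1 s / (2 * √(U s)) * Real.cos (τ s - c)
      - √(U s) * (Real.sin (τ s - c) * τ1 s)) (√(U s) * Real.cos (τ s - c)) s := by
  have hR := Real.sqrt_pos.2 (hpos s)
  have hRsq := Real.sq_sqrt (hpos s).le
  have dR := (hU s).sqrt (hpos s).ne'
  have dτ := (hτ s).sub_const c
  have d1 := dR.fun_mul dτ.cos
  refine ⟨d1.congr_deriv (by ring), ?_⟩
  have d2 := ((hU1.fun_div (dR.const_mul 2) (by positivity)).fun_mul dτ.cos).fun_sub
    (dR.fun_mul (dτ.sin.fun_mul hτ1))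
  refine d2.congr_deriv ?_
  have e3 : τ2 = -(U1 s * τ1 s) / √(U s) ^ 2 := by
    rw [hRsq, eq_div_iff (hpos s).ne']; linarith
  rw [e3, e2]
  set R := √(U s)
  rw [← hRsq]
  field_simp
  ring

lemma sqrt_mul_cos_eq_exp {U U1 U2 τ τ1 τ2 : ℝ → ℝ}
    (hU : ∀ s, HasDerivAt U (U1 s) s) (hU1 : ∀ s, HasDerivAt U1 (U2 s) s)
    (hτ : ∀ s, HasDerivAt τ (τ1 s) s) (hτ1 : ∀ s, HasDerivAt τ1 (τ2 s) s) (hpos : ∀ s, 0 < U s)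
    (e1 : ∀ s, U1 s * τ1 s + U s * τ2 s = 0)
    (e2 : ∀ s, U2 s = U1 s ^ 2 / (2 * U s) + 2 * U s * (1 + τ1 s ^ 2)) (c : ℝ) :
    ∃ A B : ℝ, ∀ s, √(U s) * Real.cos (τ s - c) = A * Real.exp s + B * Real.exp (-s) :=
  eq_exp_add_exp_of_hasDerivAt
    (fun s => (hasDerivAt_sqrt_mul_cos c hU (hU1 s) hτ (hτ1 s) hpos (e1 s) (e2 s)).1)
    (fun s => (hasDerivAt_sqrt_mul_cos c hU (hU1 s) hτ (hτ1 s) hpos (e1 s) (e2 s)).2)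

/-- The limit of a function `√U cos (τ - c) = A eˢ + B e⁻ˢ` at `+∞`, rescaled. -/
lemma exists_amplitude_atTop {U τ : ℝ → ℝ} {τ' : ℝ} (hpos : ∀ s, 0 < U s)
    (h : ∀ c, ∃ A B : ℝ, ∀ s, √(U s) * Real.cos (τ s - c) = A * Real.exp s + B * Real.exp (-s))
    (hU : Tendsto U atTop atTop) (hτ : Tendsto τ atTop (𝓝 τ')) :
    ∃ a > 0, ∀ c A B : ℝ,
      (∀ s, √(U s) * Real.cos (τ s - c) = A * Real.exp s + B * Real.exp (-s)) →
      A = a * Real.cos (τ' - c) := by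
  have lim : ∀ A B : ℝ, Tendsto (fun s => (A * Real.exp s + B * Real.exp (-s)) * Real.exp (-s))
      atTop (𝓝 A) := by
    intro A B
    have h0 := Real.tendsto_exp_neg_atTop_nhds_zero
    have h1 := ((h0.mul h0).const_mul B).const_add A
    simp only [mul_zero, add_zero] at h1
    refine h1.congr fun s => ?_
    have e3 : Real.exp (-s) * Real.exp s = 1 := by rw [← Real.exp_add]; simp
    linear_combination (-A) * e3
  -- The directions `0` and `π/2` give the cosine and sine components, whose squares add up to `U`.
  obtain ⟨A0, B0, h0⟩ := h 0
  obtain ⟨A1, B1, h1⟩ := h (Real.pi / 2)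
  have hsq : ∀ s, U s = (A0 * Real.exp s + B0 * Real.exp (-s)) ^ 2
      + (A1 * Real.exp s + B1 * Real.exp (-s)) ^ 2 := by
    intro s
    rw [← h0, ← h1, Real.cos_sub_pi_div_two, mul_pow, mul_pow, Real.sq_sqrt (hpos s).le, sub_zero]
    linear_combination (-U s) * Real.sin_sq_add_cos_sq (τ s)
  have hlim : Tendsto (fun s => √(U s) * Real.exp (-s)) atTop (𝓝 √(A0 ^ 2 + A1 ^ 2)) := by
    have := (((lim A0 B0).pow 2).add ((lim A1 B1).pow 2)).sqrt
    refine this.congr fun s => ?_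
    rw [mul_pow, mul_pow, ← add_mul, ← hsq, Real.sqrt_mul (hpos s).le,
      Real.sqrt_sq (Real.exp_pos _).le]
  -- If both growing coefficients vanished, `U` would tend to `0` instead of infinity.
  have hne : 0 < √(A0 ^ 2 + A1 ^ 2) := by
    refine Real.sqrt_pos.2 (lt_of_le_of_ne (by positivity) fun h => ?_)
    have hA0 : A0 = 0 := by nlinarith [sq_nonneg A0, sq_nonneg A1]
    have hA1 : A1 = 0 := by nlinarith [sq_nonneg A0, sq_nonneg A1]
    have hb : Tendsto U atTop (𝓝 ((B0 * 0) ^ 2 + (B1 * 0) ^ 2)) := by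
      have h0 := Real.tendsto_exp_neg_atTop_nhds_zero
      refine (((h0.const_mul B0).pow 2).add ((h0.const_mul B1).pow 2)).congr fun s => ?_
      rw [hsq, hA0, hA1]; ring
    exact not_tendsto_atTop_of_tendsto_nhds hb hU
  refine ⟨_, hne, fun c A B hAB => ?_⟩
  have l1 := hlim.mul ((Real.continuous_cos.tendsto _).comp (hτ.sub_const c))
  refine tendsto_nhds_unique (lim A B) (l1.congr fun s => ?_)
  simp only [← hAB, Function.comp_apply]; ring

lemma exists_amplitudes {U τ : ℝ → ℝ} {τ₀ τ' : ℝ} (hpos : ∀ s, 0 < U s)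
    (h : ∀ c, ∃ A B : ℝ, ∀ s, √(U s) * Real.cos (τ s - c) = A * Real.exp s + B * Real.exp (-s))
    (hU : Tendsto U atTop atTop) (hτ : Tendsto τ atTop (𝓝 τ'))
    (hU0 : Tendsto U atBot atTop) (hτ0 : Tendsto τ atBot (𝓝 τ₀)) :
    ∃ a > 0, ∃ b > 0, ∀ c s, √(U s) * Real.cos (τ s - c) =
      a * Real.cos (τ' - c) * Real.exp s + b * Real.cos (τ₀ - c) * Real.exp (-s) := by
  obtain ⟨a, ha, hA⟩ := exists_amplitude_atTop hpos h hU hτ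
  -- Reversing the parameter turns the other end into the same statement, with the two exponentials
  -- exchanged.
  obtain ⟨b, hb, hB⟩ := exists_amplitude_atTop (U := fun s => U (-s)) (τ := fun s => τ (-s))
    (fun s => hpos _) (fun c => by
      obtain ⟨A, B, hAB⟩ := h c
      exact ⟨B, A, fun s => by rw [hAB, neg_neg]; ring⟩)
    (hU0.comp tendsto_neg_atTop_atBot) (hτ0.comp tendsto_neg_atTop_atBot)
  refine ⟨a, ha, b, hb, fun c s => ?_⟩
  obtain ⟨A, B, hAB⟩ := h c
  rw [hAB, hA c A B hAB, hB c B A fun s => by rw [hAB, neg_neg]; ring]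

lemma eq_of_sqrt_mul_cos {U τ : ℝ → ℝ} {τ₀ τ' a b : ℝ} (hpos : ∀ s, 0 < U s)
    (h : ∀ c s, √(U s) * Real.cos (τ s - c) =
      a * Real.cos (τ' - c) * Real.exp s + b * Real.cos (τ₀ - c) * Real.exp (-s)) (s : ℝ) :
    U s = a ^ 2 * Real.exp (2 * s) + b ^ 2 * Real.exp (-(2 * s))
      + 2 * (a * b * Real.cos (τ' - τ₀)) := by
  have h0 := h 0 s
  have h1 := h (Real.pi / 2) s
  simp only [Real.cos_sub_pi_div_two, sub_zero] at h0 h1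
  have e3 : Real.exp (-s) * Real.exp s = 1 := by rw [← Real.exp_add]; simp
  have e4 : Real.exp (2 * s) = Real.exp s ^ 2 := by rw [two_mul, Real.exp_add, sq]
  have e5 : Real.exp (-(2 * s)) = Real.exp (-s) ^ 2 := by
    rw [← mul_neg, two_mul, Real.exp_add, sq]
  have hU : U s = (√(U s) * Real.cos (τ s)) ^ 2 + (√(U s) * Real.sin (τ s)) ^ 2 := by
    rw [mul_pow, mul_pow, Real.sq_sqrt (hpos s).le]
    linear_combination (-U s) * Real.sin_sq_add_cos_sq (τ s)
  rw [hU, h0, h1, e4, e5, Real.cos_sub]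
  linear_combination (a ^ 2 * Real.exp s ^ 2) * Real.sin_sq_add_cos_sq τ'
    + (b ^ 2 * Real.exp (-s) ^ 2) * Real.sin_sq_add_cos_sq τ₀
    + 2 * a * b * (Real.cos τ' * Real.cos τ₀ + Real.sin τ' * Real.sin τ₀) * e3

lemma exp_coeff_eq {α β c k : ℝ}
    (h : ∀ s : ℝ, α * Real.exp (2 * s) + β * Real.exp (-(2 * s)) + c = k) :
    α = 0 ∧ β = 0 ∧ c = k := by
  -- With `y = exp (2 s)`, the three values `1`, `2`, `1/2` determine the three coefficients.
  have key : ∀ y : ℝ, 0 < y → α * y + β * y⁻¹ + c = k := fun y hy => by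
    have := h (Real.log y / 2)
    rwa [mul_div_cancel₀ _ (two_ne_zero), Real.exp_neg, Real.exp_log hy] at this
  have h1 := key 1 one_pos
  have h2 := key 2 two_pos
  have h3 := key 2⁻¹ (by norm_num)
  norm_num at h1 h2 h3
  exact ⟨by linarith, by linarith, by linarith⟩

/-! ### The geodesic equation in global coordinates -/

/-- The `t` and `φ` components combine linearly into conservation of `U T'` and `u Φ'`. The single
radial equation is rewritten in two ways by means of the unit-speed condition, once for the plane
with radius `√U` and once for that with radius `√u`; unit speed produces the `1 +` in both. -/
lemma geodesic_ode (hM0 : M < 0) (hJ : |J| < |M|) {γ : ℝ → Event}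
    (hγ : IsSpacelikeGeodesic M J γ) :
    ∃ v a : ℝ → Event, (∀ s i, HasDerivAt (fun σ => γ σ i) (v s i) s) ∧
      (∀ s i, HasDerivAt (fun σ => v σ i) (a s i) s) ∧ ∀ s,
      v s 1 * globalTime M J (v s 0) (v s 2)
        + (γ s 1 + bPlus M J ^ 2) * globalTime M J (a s 0) (a s 2) = 0 ∧
      v s 1 * globalAngle M J (v s 0) (v s 2)
        + (γ s 1 + bMinus M J ^ 2) * globalAngle M J (a s 0) (a s 2) = 0 ∧
      a s 1 = v s 1 ^ 2 / (2 * (γ s 1 + bPlus M J ^ 2))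
        + 2 * (γ s 1 + bPlus M J ^ 2) * (1 + globalTime M J (v s 0) (v s 2) ^ 2) ∧
      a s 1 = v s 1 ^ 2 / (2 * (γ s 1 + bMinus M J ^ 2))
        + 2 * (γ s 1 + bMinus M J ^ 2) * (1 + globalAngle M J (v s 0) (v s 2) ^ 2) := by
  obtain ⟨hC, hb, hn, hg⟩ := hγ
  have hC1 : ContDiff ℝ 1 (deriv γ) := ((contDiff_succ_iff_deriv (n := 1)).1 hC).2.2
  have dγ : ∀ s i, HasDerivAt (fun σ => γ σ i) (deriv γ s i) s := fun s =>
    hasDerivAt_pi.1 ((hC.differentiable (by norm_num)).differentiableAt.hasDerivAt)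
  have dv : ∀ s i, HasDerivAt (fun σ => deriv γ σ i) (deriv (deriv γ) s i) s := fun s =>
    hasDerivAt_pi.1 ((hC1.differentiable (by norm_num)).differentiableAt.hasDerivAt)
  refine ⟨deriv γ, deriv (deriv γ), dγ, dv, fun s => ?_⟩
  have h1 := sq_bPlus_add_sq_bMinus hJ
  have h2 := two_mul_bPlus_mul_bMinus hJ
  rw [abs_of_neg hM0] at h1
  have hK := gap_pos hJ
  have hu := inner_pos (hb s)
  have hU := outer_pos hJ (hb s)
  have hUu := outer_eq (M := M) (J := J) (γ s)
  have g0 := hg s 0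
  have g1 := hg s 1
  have g2 := hg s 2
  rw [half_sum_fderiv_metric hM0 hJ (hb s)] at g0 g1 g2
  simp only [metric, Fin.sum_univ_three, radial_factor hM0 hJ] at g0 g1 g2
  simp [-neg_add_rev, -neg_sub] at g0 g1 g2
  have k0 := ((((dγ s 1).sub_const M).fun_mul (dv s 0)).fun_neg.fun_add
    ((dv s 2).const_mul (-J / 2))).unique g0
  have k2 := (((dv s 0).const_mul (-J / 2)).fun_add ((dγ s 1).fun_mul (dv s 2))).unique g2
  have k1 := (((((((dγ s 1).add_const (bMinus M J ^ 2)).fun_mul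
    ((dγ s 1).add_const (bPlus M J ^ 2))).const_mul 4).fun_inv (by positivity)).fun_mul
      (dv s 1)).congr_of_eventuallyEq (Eventually.of_forall fun σ => by
        simp only [mul_inv]; ring)).unique g1
  have norm := congrArg (gap M J * ·) (hn s)
  simp only [gap_mul_metricInner hM0 hJ] at norm
  have norm' : -(γ s 1 + bPlus M J ^ 2) * globalTime M J (deriv γ s 0) (deriv γ s 2) ^ 2
      + (γ s 1 + bMinus M J ^ 2) * globalAngle M J (deriv γ s 0) (deriv γ s 2) ^ 2
      + gap M J * (deriv γ s 1 ^ 2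
        / (4 * ((γ s 1 + bMinus M J ^ 2) * (γ s 1 + bPlus M J ^ 2)))) = gap M J := by
    linear_combination norm
  have hdiff : gap M J * (-deriv γ s 0 ^ 2 + deriv γ s 2 ^ 2) =
      globalAngle M J (deriv γ s 0) (deriv γ s 2) ^ 2
        - globalTime M J (deriv γ s 0) (deriv γ s 2) ^ 2 := by
    unfold gap globalTime globalAngle; ring
  set X := deriv γ s 1 ^ 2 / (4 * ((γ s 1 + bMinus M J ^ 2) * (γ s 1 + bPlus M J ^ 2))) with hX
  have radial : deriv (deriv γ) s 1 = 2 * (γ s 1 + bMinus M J ^ 2) * (γ s 1 + bPlus M J ^ 2)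
      * (-deriv γ s 0 ^ 2 + deriv γ s 2 ^ 2)
      + 2 * X * (2 * γ s 1 + bMinus M J ^ 2 + bPlus M J ^ 2) := by
    rw [hX]
    field_simp at k1 ⊢
    linear_combination 2 * k1
  have hX1 : deriv γ s 1 ^ 2 / (2 * (γ s 1 + bPlus M J ^ 2)) =
      2 * (γ s 1 + bMinus M J ^ 2) * X := by
    rw [hX]; field_simp; ring
  have hX2 : deriv γ s 1 ^ 2 / (2 * (γ s 1 + bMinus M J ^ 2)) =
      2 * (γ s 1 + bPlus M J ^ 2) * X := by
    rw [hX]; field_simp; ring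
  refine ⟨?_, ?_, ?_, ?_⟩
  · unfold globalTime
    linear_combination (-bPlus M J) * k0 + bMinus M J * k2
      + bPlus M J * deriv (deriv γ) s 0 * h1
      + (bPlus M J * deriv (deriv γ) s 2 - bMinus M J * deriv (deriv γ) s 0) / 2 * h2
  · unfold globalAngle
    linear_combination (-bMinus M J) * k0 + bPlus M J * k2
      + bMinus M J * deriv (deriv γ) s 0 * h1
      + (bMinus M J * deriv (deriv γ) s 2 - bPlus M J * deriv (deriv γ) s 0) / 2 * h2
  · rw [hX1]
    refine mul_left_cancel₀ hK.ne' ?_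
    linear_combination gap M J * radial + 2 * (γ s 1 + bPlus M J ^ 2) * norm'
      + 2 * (γ s 1 + bMinus M J ^ 2) * (γ s 1 + bPlus M J ^ 2) * hdiff
      + 2 * (γ s 1 + bPlus M J ^ 2) * globalTime M J (deriv γ s 0) (deriv γ s 2) ^ 2 * hUu
  · rw [hX2]
    refine mul_left_cancel₀ hK.ne' ?_
    linear_combination gap M J * radial + 2 * (γ s 1 + bMinus M J ^ 2) * norm'
      + 2 * (γ s 1 + bMinus M J ^ 2) * (γ s 1 + bPlus M J ^ 2) * hdiff
      + 2 * (γ s 1 + bMinus M J ^ 2) * globalAngle M J (deriv γ s 0) (deriv γ s 2) ^ 2 * hUu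

/-! ### Complete geodesics and their renormalized lengths -/

lemma TendsToBdy.globalTime {γ : ℝ → Event} {l : Filter ℝ} {P : BdyPoint}
    (h : TendsToBdy γ l P) :
    Tendsto (fun s => globalTime M J (γ s 0) (γ s 2)) l (𝓝 (globalTime M J P.1 P.2)) :=
  (h.1.const_mul _).add (h.2.2.const_mul _)

lemma TendsToBdy.globalAngle {γ : ℝ → Event} {l : Filter ℝ} {P : BdyPoint}
    (h : TendsToBdy γ l P) :
    Tendsto (fun s => globalAngle M J (γ s 0) (γ s 2)) l (𝓝 (globalAngle M J P.1 P.2)) :=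
  (h.2.2.const_mul _).add (h.1.const_mul _)

/-- The momentum `U τ'` is conserved and `U > 0`, so `τ'` has constant sign. This confines the
unwrapped coordinates, which the embedding sees only modulo `2π`. -/
lemma mem_uIcc_of_momentum_const {U U1 τ τ1 τ2 : ℝ → ℝ} {τ₀ τ' : ℝ}
    (hU : ∀ s, HasDerivAt U (U1 s) s) (hτ : ∀ s, HasDerivAt τ (τ1 s) s)
    (hτ1 : ∀ s, HasDerivAt τ1 (τ2 s) s) (hpos : ∀ s, 0 < U s)
    (e1 : ∀ s, U1 s * τ1 s + U s * τ2 s = 0) (h0 : Tendsto τ atBot (𝓝 τ₀))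
    (h1 : Tendsto τ atTop (𝓝 τ')) (s : ℝ) : τ s ∈ Set.uIcc τ₀ τ' := by
  have hd : ∀ s, HasDerivAt (fun s => U s * τ1 s) 0 s := fun s =>
    ((hU s).fun_mul (hτ1 s)).congr_deriv (e1 s)
  have hc : ∀ s, U s * τ1 s = U 0 * τ1 0 := fun s =>
    is_const_of_deriv_eq_zero (fun s => (hd s).differentiableAt) (fun s => (hd s).deriv) s 0
  have hdiff : Differentiable ℝ τ := fun s => (hτ s).differentiableAt
  rcases le_total 0 (U 0 * τ1 0) with h | h
  · have hm : Monotone τ := monotone_of_deriv_nonneg hdiff fun s => by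
      rw [(hτ s).deriv]
      exact nonneg_of_mul_nonneg_right (by rwa [hc]) (hpos s)
    exact Set.mem_uIcc_of_le (hm.le_of_tendsto h0 s) (hm.ge_of_tendsto h1 s)
  · have hm : Antitone τ := antitone_of_deriv_nonpos hdiff fun s => by
      rw [(hτ s).deriv]
      exact nonpos_of_mul_nonpos_right (by rwa [hc]) (hpos s)
    exact Set.mem_uIcc_of_ge (hm.le_of_tendsto h1 s) (hm.ge_of_tendsto h0 s)

/-- The embedding coordinates of a complete geodesic, up to the factor `√(b₊² - b₋²)`, are those of
`a eˢ N(Q) + b e⁻ˢ N(P)` with `N(P)`, `N(Q)` the null vectors of its endpoints. -/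
lemma IsExtremalCurve.embedding (hM0 : M < 0) (hJ : |J| < |M|) {P Q : BdyPoint} {γ : ℝ → Event}
    (hγ : IsExtremalCurve M J P Q γ) :
    ∃ a > 0, ∃ b > 0,
      (∀ c s, √(γ s 1 + bPlus M J ^ 2) * Real.cos (globalTime M J (γ s 0) (γ s 2) - c) =
        a * Real.cos (globalTime M J Q.1 Q.2 - c) * Real.exp s
        + b * Real.cos (globalTime M J P.1 P.2 - c) * Real.exp (-s)) ∧
      (∀ c s, √(γ s 1 + bMinus M J ^ 2) * Real.cos (globalAngle M J (γ s 0) (γ s 2) - c) =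
        a * Real.cos (globalAngle M J Q.1 Q.2 - c) * Real.exp s
        + b * Real.cos (globalAngle M J P.1 P.2 - c) * Real.exp (-s)) ∧
      2 * (a * b) * (Real.cos (globalTime M J Q.1 Q.2 - globalTime M J P.1 P.2)
        - Real.cos (globalAngle M J Q.1 Q.2 - globalAngle M J P.1 P.2)) = gap M J ∧
      (∀ s, globalTime M J (γ s 0) (γ s 2) ∈
        Set.uIcc (globalTime M J P.1 P.2) (globalTime M J Q.1 Q.2)) ∧
      (∀ s, globalAngle M J (γ s 0) (γ s 2) ∈
        Set.uIcc (globalAngle M J P.1 P.2) (globalAngle M J Q.1 Q.2)) := by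
  obtain ⟨hg, hP, hQ⟩ := hγ
  obtain ⟨v, w, dγ, dv, hode⟩ := geodesic_ode hM0 hJ hg
  have dT : ∀ s, HasDerivAt (fun s => globalTime M J (γ s 0) (γ s 2))
      (globalTime M J (v s 0) (v s 2)) s := fun s =>
    ((dγ s 0).const_mul _).fun_add ((dγ s 2).const_mul _)
  have dT1 : ∀ s, HasDerivAt (fun s => globalTime M J (v s 0) (v s 2))
      (globalTime M J (w s 0) (w s 2)) s := fun s =>
    ((dv s 0).const_mul _).fun_add ((dv s 2).const_mul _)
  have dA : ∀ s, HasDerivAt (fun s => globalAngle M J (γ s 0) (γ s 2))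
      (globalAngle M J (v s 0) (v s 2)) s := fun s =>
    ((dγ s 2).const_mul _).fun_add ((dγ s 0).const_mul _)
  have dA1 : ∀ s, HasDerivAt (fun s => globalAngle M J (v s 0) (v s 2))
      (globalAngle M J (w s 0) (w s 2)) s := fun s =>
    ((dv s 2).const_mul _).fun_add ((dv s 0).const_mul _)
  have pU : ∀ s, 0 < γ s 1 + bPlus M J ^ 2 := fun s => outer_pos hJ (hg.2.1 s)
  have pu : ∀ s, 0 < γ s 1 + bMinus M J ^ 2 := fun s => inner_pos (hg.2.1 s)
  have dU : ∀ s, HasDerivAt (fun s => γ s 1 + bPlus M J ^ 2) (v s 1) s := fun s =>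
    (dγ s 1).add_const _
  have du : ∀ s, HasDerivAt (fun s => γ s 1 + bMinus M J ^ 2) (v s 1) s := fun s =>
    (dγ s 1).add_const _
  obtain ⟨a, ha, b, hb, hab⟩ := exists_amplitudes pU
    (sqrt_mul_cos_eq_exp dU (fun s => dv s 1) dT dT1 pU (fun s => (hode s).1)
      (fun s => (hode s).2.2.1))
    (tendsto_atTop_add_const_right _ _ hQ.2.1) hQ.globalTime
    (tendsto_atTop_add_const_right _ _ hP.2.1) hP.globalTime
  obtain ⟨a', ha', b', hb', hab'⟩ := exists_amplitudes pu
    (sqrt_mul_cos_eq_exp du (fun s => dv s 1) dA dA1 pu (fun s => (hode s).2.1)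
      (fun s => (hode s).2.2.2))
    (tendsto_atTop_add_const_right _ _ hQ.2.1) hQ.globalAngle
    (tendsto_atTop_add_const_right _ _ hP.2.1) hP.globalAngle
  have h1 := eq_of_sqrt_mul_cos pU hab
  have h2 := eq_of_sqrt_mul_cos pu hab'
  -- The two planes yield amplitudes separately. Comparing coefficients in `U - u = gap` identifies
  -- them, and the constant term is the normalization of `a * b`.
  obtain ⟨e1, e2, e3⟩ := exp_coeff_eq (α := a ^ 2 - a' ^ 2) (β := b ^ 2 - b' ^ 2)
    (c := 2 * (a * b * Real.cos (globalTime M J Q.1 Q.2 - globalTime M J P.1 P.2))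
      - 2 * (a' * b' * Real.cos (globalAngle M J Q.1 Q.2 - globalAngle M J P.1 P.2)))
    (k := gap M J) (fun s => by
      have h3 := outer_eq (M := M) (J := J) (γ s)
      linear_combination h3 - h1 s + h2 s)
  have ea : a' = a := by
    rw [← sq_eq_sq₀ ha'.le ha.le]; linarith
  have eb : b' = b := by
    rw [← sq_eq_sq₀ hb'.le hb.le]; linarith
  subst ea eb
  exact ⟨a', ha', b', hb', hab, hab', by rw [← e3]; ring,
    mem_uIcc_of_momentum_const dU dT dT1 pU (fun s => (hode s).1) hP.globalTime hQ.globalTime,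
    mem_uIcc_of_momentum_const du dA dA1 pu (fun s => (hode s).2.1) hP.globalAngle hQ.globalAngle⟩

/-- The left side is `2ab cosh(2s - log(b/a))`. The interval has length `arcosh Y`, which is the
cutoff length of the geodesic. -/
lemma setOf_cosh_le {a b Y : ℝ} (ha : 0 < a) (hb : 0 < b) (hY : 1 ≤ Y) :
    {s : ℝ | a ^ 2 * Real.exp (2 * s) + b ^ 2 * Real.exp (-(2 * s)) ≤ 2 * (a * b) * Y} =
      Set.Icc ((Real.log b - Real.log a - Real.arcosh Y) / 2)
        ((Real.log b - Real.log a + Real.arcosh Y) / 2) := by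
  ext s
  have e : a ^ 2 * Real.exp (2 * s) + b ^ 2 * Real.exp (-(2 * s)) =
      2 * (a * b) * Real.cosh (2 * s - (Real.log b - Real.log a)) := by
    rw [Real.cosh_eq, show -(2 * s - (Real.log b - Real.log a)) =
      -(2 * s) + Real.log b - Real.log a by ring, show 2 * s - (Real.log b - Real.log a) =
      2 * s + Real.log a - Real.log b by ring, Real.exp_sub, Real.exp_sub, Real.exp_add,
      Real.exp_add, Real.exp_log ha, Real.exp_log hb]
    field_simp
  rw [Set.mem_ofPred_eq, e, mul_le_mul_iff_right₀ (by positivity)]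
  nth_rw 1 [← Real.cosh_arcosh hY]
  rw [Real.cosh_le_cosh, abs_of_nonneg (Real.arcosh_nonneg hY), abs_le, Set.mem_Icc]
  constructor <;> rintro ⟨h1, h2⟩ <;> constructor <;> linarith

lemma tendsto_arcosh_sub_log {k c : ℝ} (hk : 0 < k) :
    Tendsto (fun ε : ℝ => Real.arcosh (((1 / ε) ^ 2 + c) / (2 * k)) - 2 * Real.log (1 / ε))
      (𝓝[>] 0) (𝓝 (-Real.log k)) := by
  -- In `arcosh Y = log (Y + √(Y² - 1))` a factor `ε⁻²` is pulled out of the logarithm, and what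
  -- remains is continuous at `ε = 0`.
  have h1 : Tendsto (fun ε : ℝ => Real.log ((1 + c * ε ^ 2) / (2 * k)
      + √(((1 + c * ε ^ 2) / (2 * k)) ^ 2 - ε ^ 4))) (𝓝 0) (𝓝 (-Real.log k)) := by
    have hc : Continuous fun ε : ℝ => (1 + c * ε ^ 2) / (2 * k)
        + √(((1 + c * ε ^ 2) / (2 * k)) ^ 2 - ε ^ 4) := by fun_prop
    have h0 : (1 + c * (0 : ℝ) ^ 2) / (2 * k)
        + √(((1 + c * (0 : ℝ) ^ 2) / (2 * k)) ^ 2 - 0 ^ 4) = k⁻¹ := by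
      have : √((1 / (2 * k)) ^ 2) = 1 / (2 * k) := Real.sqrt_sq (by positivity)
      norm_num at this ⊢
      rw [this]
      field_simp
      norm_num
    have := (hc.tendsto 0).log (by rw [h0]; positivity)
    rwa [h0, Real.log_inv] at this
  refine (h1.mono_left nhdsWithin_le_nhds).congr' ?_
  have hpos : ∀ᶠ ε : ℝ in 𝓝[>] 0, 0 < (1 + c * ε ^ 2) / (2 * k) := by
    have hc : Continuous fun ε : ℝ => (1 + c * ε ^ 2) / (2 * k) := by fun_prop
    refine nhdsWithin_le_nhds ((hc.tendsto 0).eventually_const_lt ?_)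
    simp only [ne_eq, OfNat.ofNat_ne_zero, not_false_eq_true, zero_pow, mul_zero, add_zero]
    positivity
  filter_upwards [hpos, self_mem_nhdsWithin] with ε h2 hε
  have hε' : (0 : ℝ) < ε := hε
  rw [Real.arcosh, show 2 * Real.log (1 / ε) = Real.log ((1 / ε) ^ 2) by
    rw [Real.log_pow]; norm_num, ← Real.log_div]
  · congr 1
    have e1 : ((1 / ε) ^ 2 + c) / (2 * k) = (1 + c * ε ^ 2) / (2 * k) / ε ^ 2 := by
      field_simp
    rw [e1, show ((1 + c * ε ^ 2) / (2 * k) / ε ^ 2) ^ 2 - 1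
      = (((1 + c * ε ^ 2) / (2 * k)) ^ 2 - ε ^ 4) / (ε ^ 2) ^ 2 by field_simp,
      Real.sqrt_div' _ (by positivity), Real.sqrt_sq (by positivity)]
    field_simp
  · have e1 : ((1 / ε) ^ 2 + c) / (2 * k) = (1 + c * ε ^ 2) / (2 * k) / ε ^ 2 := by
      field_simp
    rw [e1]
    positivity
  · positivity

lemma IsExtremalCurve.hasRenLength (hM0 : M < 0) (hJ : |J| < |M|) {P Q : BdyPoint}
    {γ : ℝ → Event} (hγ : IsExtremalCurve M J P Q γ) :
    HasRenLength M J γ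
      (Real.log (2 * (Real.cos (globalTime M J Q.1 Q.2 - globalTime M J P.1 P.2)
        - Real.cos (globalAngle M J Q.1 Q.2 - globalAngle M J P.1 P.2))) - Real.log (gap M J)) := by
  obtain ⟨a, ha, b, hb, -, hab', hg, -, -⟩ := hγ.embedding hM0 hJ
  set D := Real.cos (globalTime M J Q.1 Q.2 - globalTime M J P.1 P.2)
        - Real.cos (globalAngle M J Q.1 Q.2 - globalAngle M J P.1 P.2)
  have hK := gap_pos hJ
  have hk : 0 < a * b := by positivity
  have hD : D ≠ 0 := by
    rintro h
    rw [h, mul_zero] at hg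
    exact hK.ne hg
  have hu := eq_of_sqrt_mul_cos (fun s => inner_pos (hγ.1.2.1 s)) hab'
  set C := Real.cos (globalAngle M J Q.1 Q.2 - globalAngle M J P.1 P.2)
  have hl : Real.log (2 * D) - Real.log (gap M J) = -Real.log (a * b) := by
    rw [← hg, show 2 * (a * b) * D = 2 * D * (a * b) by ring,
      Real.log_mul (by positivity) hk.ne']
    ring
  rw [hl]
  refine (tendsto_arcosh_sub_log (c := bMinus M J ^ 2 - 2 * (a * b * C)) hk).congr' ?_
  have hY : ∀ᶠ ε : ℝ in 𝓝[>] 0,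
      1 ≤ ((1 / ε) ^ 2 + (bMinus M J ^ 2 - 2 * (a * b * C))) / (2 * (a * b)) := by
    have h1 : Tendsto (fun ε : ℝ => ((1 / ε) ^ 2 + (bMinus M J ^ 2 - 2 * (a * b * C)))
        / (2 * (a * b))) (𝓝[>] 0) atTop := by
      refine Tendsto.atTop_div_const (by positivity) (tendsto_atTop_add_const_right _ _ ?_)
      simp only [one_div]
      exact (tendsto_pow_atTop two_ne_zero).comp tendsto_inv_nhdsGT_zero
    exact h1.eventually_ge_atTop 1
  filter_upwards [hY] with ε hε
  congr 1
  have hset : {s : ℝ | γ s 1 ≤ (1 / ε) ^ 2} = {s : ℝ | a ^ 2 * Real.exp (2 * s)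
      + b ^ 2 * Real.exp (-(2 * s)) ≤ 2 * (a * b) *
        (((1 / ε) ^ 2 + (bMinus M J ^ 2 - 2 * (a * b * C))) / (2 * (a * b)))} := by
    ext s
    rw [Set.mem_ofPred_eq, Set.mem_ofPred_eq, mul_div_cancel₀ _ (by positivity)]
    have := hu s
    constructor <;> intro h <;> linarith
  simp only [cutoffLength, hγ.1.2.2.1, Real.sqrt_one, hset, setOf_cosh_le ha hb hε]
  have := Real.arcosh_nonneg hε
  simp only [integral_const, smul_eq_mul, mul_one, MeasurableSet.univ, measureReal_restrict_apply,
    Set.univ_inter]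
  rw [Real.volume_real_Icc_of_le (by linarith)]
  ring

/-! ### Existence of complete geodesics -/

/-- A converse to `geodesic_ode`: the covariant `t` and `φ` components of the velocity are fixed
linear combinations of the momenta `L` and `L'`, hence constant. -/
lemma isSpacelikeGeodesic_of_global (hM0 : M < 0) (hJ : |J| < |M|) {γ v : ℝ → Event}
    {a : ℝ → ℝ} {L L' : ℝ} (hC : ContDiff ℝ 2 γ) (hb : ∀ s, γ s ∈ bulk M J)
    (dγ : ∀ s i, HasDerivAt (fun σ => γ σ i) (v s i) s)
    (dv : ∀ s, HasDerivAt (fun σ => v σ 1) (a s) s)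
    (hT : ∀ s, (γ s 1 + bPlus M J ^ 2) * globalTime M J (v s 0) (v s 2) = L)
    (hA : ∀ s, (γ s 1 + bMinus M J ^ 2) * globalAngle M J (v s 0) (v s 2) = L')
    (ha : ∀ s, gap M J * a s = 2 * (γ s 1 + bMinus M J ^ 2) * (γ s 1 + bPlus M J ^ 2)
      * (globalAngle M J (v s 0) (v s 2) ^ 2 - globalTime M J (v s 0) (v s 2) ^ 2)
      + gap M J * v s 1 ^ 2 / (2 * ((γ s 1 + bMinus M J ^ 2) * (γ s 1 + bPlus M J ^ 2)))
        * (2 * γ s 1 + bMinus M J ^ 2 + bPlus M J ^ 2))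
    (hn : ∀ s, -(γ s 1 + bPlus M J ^ 2) * globalTime M J (v s 0) (v s 2) ^ 2
      + (γ s 1 + bMinus M J ^ 2) * globalAngle M J (v s 0) (v s 2) ^ 2
      + gap M J * v s 1 ^ 2 / (4 * ((γ s 1 + bMinus M J ^ 2) * (γ s 1 + bPlus M J ^ 2)))
        = gap M J) :
    IsSpacelikeGeodesic M J γ := by
  have hd : deriv γ = v := funext fun s => (hasDerivAt_pi.2 (dγ s)).deriv
  have h1 := sq_bPlus_add_sq_bMinus hJ
  have h2 := two_mul_bPlus_mul_bMinus hJ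
  rw [abs_of_neg hM0] at h1
  have hK := gap_pos hJ
  refine ⟨hC, hb, fun s => ?_, fun s i => ?_⟩
  · rw [hd]
    refine mul_left_cancel₀ hK.ne' ?_
    rw [gap_mul_metricInner hM0 hJ, mul_one]
    linear_combination hn s
  · rw [hd, half_sum_fderiv_metric hM0 hJ (hb s)]
    simp only [metric, Fin.sum_univ_three, radial_factor hM0 hJ]
    fin_cases i
    · have e : (fun σ => -(γ σ 1 - M) * v σ 0 + 0 * v σ 1 + -J / 2 * v σ 2) =
          fun _ => (-bPlus M J * L + bMinus M J * L') / gap M J := by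
        ext σ
        rw [eq_div_iff hK.ne', ← hT σ, ← hA σ]
        unfold globalTime globalAngle gap
        linear_combination (bPlus M J ^ 2 - bMinus M J ^ 2) * (v σ 0 * h1 + v σ 2 / 2 * h2)
      have k := (hasDerivAt_const s _).congr_of_eventuallyEq (Eventually.of_forall (congrFun e))
      simpa using k
    · have hu := inner_pos (hb s)
      have hU := outer_pos hJ (hb s)
      have k := ((((((dγ s 1).add_const (bMinus M J ^ 2)).fun_mul
        ((dγ s 1).add_const (bPlus M J ^ 2))).const_mul 4).fun_inv (by positivity)).fun_mul (dv s))
      have hdiff : gap M J * (-v s 0 ^ 2 + v s 2 ^ 2) =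
          globalAngle M J (v s 0) (v s 2) ^ 2 - globalTime M J (v s 0) (v s 2) ^ 2 := by
        unfold gap globalTime globalAngle; ring
      have ha' := ha s
      rw [← hdiff] at ha'
      have ha2 : a s = 2 * (γ s 1 + bMinus M J ^ 2) * (γ s 1 + bPlus M J ^ 2)
          * (-v s 0 ^ 2 + v s 2 ^ 2)
          + v s 1 ^ 2 / (2 * ((γ s 1 + bMinus M J ^ 2) * (γ s 1 + bPlus M J ^ 2)))
            * (2 * γ s 1 + bMinus M J ^ 2 + bPlus M J ^ 2) := by
        refine mul_left_cancel₀ hK.ne' ?_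
        rw [ha']; ring
      have k' := k.congr_deriv (g' := (1 / 2) * (-v s 0 ^ 2 + v s 2 ^ 2
          - v s 1 ^ 2 * (2 * γ s 1 + bMinus M J ^ 2 + bPlus M J ^ 2)
          / (4 * ((γ s 1 + bMinus M J ^ 2) * (γ s 1 + bPlus M J ^ 2)) ^ 2))) (by
        rw [ha2]
        field_simp
        ring)
      simpa using k'
    · have e : (fun σ => -J / 2 * v σ 0 + 0 * v σ 1 + γ σ 1 * v σ 2) =
          fun _ => (-bMinus M J * L + bPlus M J * L') / gap M J := by
        ext σ
        rw [eq_div_iff hK.ne', ← hT σ, ← hA σ]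
        unfold globalTime globalAngle gap
        linear_combination (bPlus M J ^ 2 - bMinus M J ^ 2) * (v σ 0 / 2 * h2)
      simpa [-neg_sub, -zero_mul] using e ▸ hasDerivAt_const s _

/-- The function is the polar angle of `(cosh s cos α, sinh s sin α)`, a vector of squared norm
`sinh² s + cos² α`. -/
lemma hasDerivAt_arctan_tanh {α : ℝ} (hα : 0 < Real.cos α) (s : ℝ) :
    HasDerivAt (fun s => Real.arctan (Real.sinh s / Real.cosh s * Real.tan α))
      (Real.sin α * Real.cos α / (Real.sinh s ^ 2 + Real.cos α ^ 2)) s := by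
  have hc := Real.cosh_pos s
  have h := (((Real.hasDerivAt_sinh s).fun_div (Real.hasDerivAt_cosh s) hc.ne').mul_const
    (Real.tan α)).arctan
  refine h.congr_deriv ?_
  have e1 := Real.cosh_sq s
  have e2 := Real.sin_sq_add_cos_sq α
  have e3 : Real.cosh s * Real.cosh s - Real.sinh s * Real.sinh s = 1 := by linarith
  rw [e3, Real.tan_eq_sin_div_cos]
  have e4 : 1 + (Real.sinh s / Real.cosh s * (Real.sin α / Real.cos α)) ^ 2 =
      (Real.sinh s ^ 2 + Real.cos α ^ 2) / (Real.cosh s * Real.cos α) ^ 2 := by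
    field_simp
    rw [e1]
    linear_combination Real.sinh s ^ 2 * e2
  rw [e4]
  field_simp

lemma tendsto_sinh_div_cosh_atTop :
    Tendsto (fun s => Real.sinh s / Real.cosh s) atTop (𝓝 1) := by
  have h0 : Tendsto (fun s => Real.exp (-s) * Real.exp (-s)) atTop (𝓝 (0 * 0)) :=
    Real.tendsto_exp_neg_atTop_nhds_zero.mul Real.tendsto_exp_neg_atTop_nhds_zero
  have h1 := (h0.const_sub 1).div (h0.const_add 1) (by norm_num)
  norm_num at h1
  refine h1.congr fun s => ?_
  have e3 : Real.exp (-s) * Real.exp s = 1 := by rw [← Real.exp_add]; simp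
  have := Real.exp_pos s
  rw [Pi.div_apply, Real.sinh_eq, Real.cosh_eq, div_div_div_cancel_right₀ two_ne_zero,
    div_eq_div_iff (by positivity) (by positivity)]
  linear_combination (-2 * Real.exp (-s)) * e3

lemma tendsto_sinh_div_cosh_atBot :
    Tendsto (fun s => Real.sinh s / Real.cosh s) atBot (𝓝 (-1)) := by
  refine (tendsto_sinh_div_cosh_atTop.comp tendsto_neg_atBot_atTop).neg.congr fun s => ?_
  simp [neg_div]

lemma tendsto_sinh_sq_atTop : Tendsto (fun s => Real.sinh s ^ 2) atTop atTop := by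
  refine tendsto_atTop_mono' _ ?_ (tendsto_pow_atTop (α := ℝ) two_ne_zero)
  filter_upwards [eventually_ge_atTop 0] with s hs
  exact pow_le_pow_left₀ hs (Real.self_le_sinh_iff.2 hs) 2

lemma tendsto_sinh_sq_atBot : Tendsto (fun s => Real.sinh s ^ 2) atBot atTop := by
  refine (tendsto_sinh_sq_atTop.comp tendsto_neg_atBot_atTop).congr fun s => ?_
  simp

/-- The curve is `eˢ N(Q) + e⁻ˢ N(P)` up to scale, centred at the midpoint. With half-separations
`α` in `T` and `β` in `Φ`, its planar components are multiples of `(cosh s cos α, sinh s sin α)` and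
`(cosh s cos β, sinh s sin β)`. The condition `b₊ δ < π` means `β < π/2`. -/
lemma exists_isExtremalCurve (hM0 : M < 0) (hJ : |J| < |M|) (t φ : ℝ) {δ : ℝ} (hδ : 0 < δ)
    (hδ' : bPlus M J * δ < Real.pi) :
    ∃ γ, IsExtremalCurve M J (t, φ) (t, φ + δ) γ := by
  have hp := bPlus_pos hJ
  have hK := gap_pos hJ
  set α := bMinus M J * δ / 2 with hα
  set β := bPlus M J * δ / 2 with hβ
  have hβ0 : 0 < β := by positivity
  have hαβ : |α| < β := by
    rw [abs_lt]
    constructor <;> rw [hα, hβ] <;>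
      nlinarith [bPlus_add_bMinus_pos hJ, bPlus_sub_bMinus_pos hJ]
  obtain ⟨hαβ1, hαβ2⟩ := abs_lt.1 hαβ
  have hcβ : 0 < Real.cos β := Real.cos_pos_of_mem_Ioo ⟨by linarith, by linarith⟩
  have hcα : Real.cos β < Real.cos α := by
    rw [← Real.cos_abs α]
    exact Real.cos_lt_cos_of_nonneg_of_le_pi_div_two (abs_nonneg _) (by linarith) hαβ
  have hcα0 : 0 < Real.cos α := hcβ.trans hcα
  have hden : 0 < Real.cos α ^ 2 - Real.cos β ^ 2 := by nlinarith
  -- The scale is forced by `U - u = gap`, where `U = c (sinh² s + cos² α)` and `u = c (sinh² s +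
  -- cos² β)`.
  set c := gap M J / (Real.cos α ^ 2 - Real.cos β ^ 2) with hc
  have hc0 : 0 < c := by positivity
  have hcK : c * (Real.cos α ^ 2 - Real.cos β ^ 2) = gap M J := div_mul_cancel₀ _ hden.ne'
  set p := bPlus M J with hpdef
  set q := bMinus M J with hqdef
  set T0 := globalTime M J t (φ + δ / 2) with hT0
  set A0 := globalAngle M J t (φ + δ / 2) with hA0
  set T : ℝ → ℝ := fun s => T0 + Real.arctan (Real.sinh s / Real.cosh s * Real.tan α) with hT
  set A : ℝ → ℝ := fun s => A0 + Real.arctan (Real.sinh s / Real.cosh s * Real.tan β) with hA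
  set T1 : ℝ → ℝ := fun s => Real.sin α * Real.cos α / (Real.sinh s ^ 2 + Real.cos α ^ 2) with hT1
  set A1 : ℝ → ℝ := fun s => Real.sin β * Real.cos β / (Real.sinh s ^ 2 + Real.cos β ^ 2) with hA1
  have dT : ∀ s, HasDerivAt T (T1 s) s := fun s => (hasDerivAt_arctan_tanh hcα0 s).const_add T0
  have dA : ∀ s, HasDerivAt A (A1 s) s := fun s => (hasDerivAt_arctan_tanh hcβ s).const_add A0
  let w : ℝ → ℝ := fun s => c * (Real.sinh s ^ 2 + Real.cos β ^ 2) - q ^ 2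
  have hwu : ∀ s, w s + q ^ 2 = c * (Real.sinh s ^ 2 + Real.cos β ^ 2) := fun s => by
    simp only [w]; ring
  have hwU : ∀ s, w s + p ^ 2 = c * (Real.sinh s ^ 2 + Real.cos α ^ 2) := fun s => by
    have : gap M J = p ^ 2 - q ^ 2 := rfl
    simp only [w]; linear_combination (-1) * this - hcK
  let γ : ℝ → Event := fun s => ![(p * T s - q * A s) / gap M J, w s,
    (p * A s - q * T s) / gap M J]
  let v : ℝ → Event := fun s => ![(p * T1 s - q * A1 s) / gap M J,
    2 * c * (Real.sinh s * Real.cosh s), (p * A1 s - q * T1 s) / gap M J]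
  have hv0 : ∀ s, globalTime M J (v s 0) (v s 2) = T1 s := fun s => globalTime_div_gap hJ _ _
  have hv2 : ∀ s, globalAngle M J (v s 0) (v s 2) = A1 s := fun s => globalAngle_div_gap hJ _ _
  have hX : ∀ s, 0 < Real.sinh s ^ 2 + Real.cos β ^ 2 := fun s => by positivity
  have hY : ∀ s, 0 < Real.sinh s ^ 2 + Real.cos α ^ 2 := fun s => by positivity
  have hcosh : ContDiff ℝ 2 (fun s => Real.sinh s / Real.cosh s) :=
    Real.contDiff_sinh.div Real.contDiff_cosh fun s => (Real.cosh_pos s).ne'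
  have sT : ContDiff ℝ 2 T := contDiff_const.add
    (Real.contDiff_arctan.comp (hcosh.mul contDiff_const))
  have sA : ContDiff ℝ 2 A := contDiff_const.add
    (Real.contDiff_arctan.comp (hcosh.mul contDiff_const))
  have sw : ContDiff ℝ 2 w := (contDiff_const.mul
    ((Real.contDiff_sinh.pow 2).add contDiff_const)).sub contDiff_const
  have sα := Real.sin_sq α
  have sβ := Real.sin_sq β
  have geod : IsSpacelikeGeodesic M J γ := by
    refine isSpacelikeGeodesic_of_global hM0 hJ (v := v)
      (a := fun s => 2 * c * (Real.cosh s * Real.cosh s + Real.sinh s * Real.sinh s))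
      (L := c * (Real.sin α * Real.cos α)) (L' := c * (Real.sin β * Real.cos β))
      ?_ ?_ ?_ ?_ ?_ ?_ ?_ ?_
    · refine contDiff_pi.2 fun i => ?_
      fin_cases i
      · exact ((contDiff_const.mul sT).sub (contDiff_const.mul sA)).div_const _
      · exact sw
      · exact ((contDiff_const.mul sA).sub (contDiff_const.mul sT)).div_const _
    · intro s
      have := mul_pos hc0 (hX s)
      have h2 := hwu s
      change -q ^ 2 < w s
      linarith
    · intro s i
      fin_cases i
      · exact (((dT s).const_mul p).fun_sub ((dA s).const_mul q)).div_const _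
      · refine (((((Real.hasDerivAt_sinh s).fun_pow 2).add_const (Real.cos β ^ 2)).const_mul
          c).sub_const (q ^ 2)).congr_deriv ?_
        simp [v]
        ring
      · exact (((dA s).const_mul p).fun_sub ((dT s).const_mul q)).div_const _
    · intro s
      exact (((Real.hasDerivAt_sinh s).fun_mul (Real.hasDerivAt_cosh s)).const_mul
        (2 * c)).congr_deriv (by ring)
    · intro s
      rw [hv0]
      change (w s + p ^ 2) * _ = _
      rw [hwU, hT1]
      have := hY s
      field_simp
    · intro s
      rw [hv2]
      change (w s + q ^ 2) * _ = _
      rw [hwu, hA1]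
      have := hX s
      field_simp
    · intro s
      rw [hv0, hv2]
      change _ = 2 * (w s + q ^ 2) * (w s + p ^ 2) * _ + _ * (2 * c * (Real.sinh s * Real.cosh s)) ^ 2 /
        (2 * ((w s + q ^ 2) * (w s + p ^ 2))) * (2 * w s + q ^ 2 + p ^ 2)
      rw [show 2 * w s + q ^ 2 + p ^ 2 = (w s + q ^ 2) + (w s + p ^ 2) by ring, hwu, hwU, ← hcK]
      simp only [hT1, hA1]
      have := hX s
      have := hY s
      simp only [div_pow, mul_pow, sα, sβ, ← sq, Real.cosh_sq]
      field_simp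
      ring
    · intro s
      rw [hv0, hv2]
      change -(w s + p ^ 2) * _ + (w s + q ^ 2) * _ + _ * (2 * c * (Real.sinh s * Real.cosh s)) ^ 2 /
        (4 * ((w s + q ^ 2) * (w s + p ^ 2))) = _
      rw [hwu, hwU, ← hcK]
      simp only [hT1, hA1]
      have := hX s
      have := hY s
      simp only [div_pow, mul_pow, sα, sβ, Real.cosh_sq]
      field_simp
      ring
  have atanα : Real.arctan (Real.tan α) = α := Real.arctan_tan (by linarith) (by linarith)
  have atanβ : Real.arctan (Real.tan β) = β := Real.arctan_tan (by linarith) (by linarith)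
  have lim : ∀ (B x : ℝ) {l : Filter ℝ} {σ : ℝ},
      Tendsto (fun s => Real.sinh s / Real.cosh s) l (𝓝 σ) →
      Tendsto (fun s => B + Real.arctan (Real.sinh s / Real.cosh s * Real.tan x)) l
        (𝓝 (B + Real.arctan (σ * Real.tan x))) := fun B x l σ h =>
    ((Real.continuous_arctan.tendsto _).comp (h.mul_const _)).const_add _
  have bdy : ∀ {l : Filter ℝ} {T' A' t' φ' : ℝ}, Tendsto T l (𝓝 T') → Tendsto A l (𝓝 A') →
      Tendsto (fun s => Real.sinh s ^ 2) l atTop → T' = globalTime M J t' φ' →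
      A' = globalAngle M J t' φ' → TendsToBdy γ l (t', φ') := by
    intro l T' A' t' φ' h1 h2 h3 h4 h5
    refine ⟨?_, ?_, ?_⟩
    · change Tendsto _ l (𝓝 t')
      rw [time_eq_of_global hJ t' φ', ← h4, ← h5]
      exact ((h1.const_mul p).sub (h2.const_mul q)).div_const _
    · exact tendsto_atTop_add_const_right _ (-q ^ 2)
        ((tendsto_atTop_add_const_right _ (Real.cos β ^ 2) h3).const_mul_atTop hc0)
    · change Tendsto _ l (𝓝 φ')
      rw [angle_eq_of_global hJ t' φ', ← h4, ← h5]
      exact ((h2.const_mul p).sub (h1.const_mul q)).div_const _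
  refine ⟨γ, geod, bdy (lim T0 α tendsto_sinh_div_cosh_atBot)
    (lim A0 β tendsto_sinh_div_cosh_atBot) tendsto_sinh_sq_atBot ?_ ?_,
    bdy (lim T0 α tendsto_sinh_div_cosh_atTop)
    (lim A0 β tendsto_sinh_div_cosh_atTop) tendsto_sinh_sq_atTop ?_ ?_⟩
  · rw [neg_one_mul, Real.arctan_neg, atanα, hT0, hα]
    unfold globalTime; ring
  · rw [neg_one_mul, Real.arctan_neg, atanβ, hA0, hβ]
    unfold globalAngle; ring
  · rw [one_mul, atanα, hT0, hα]
    unfold globalTime; ring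
  · rw [one_mul, atanβ, hA0, hβ]
    unfold globalAngle; ring

/-! ### Causal curves in global coordinates -/

/-- The orientation is given by `∂_t`, not by the global time. They agree because causality bounds
`u A²` by `U T²`, while `u b₋² ≤ U b₊²`; hence `|u A b₋| ≤ |U T b₊|`, and the sign of the product
with `∂_t` is governed by `T`. -/
lemma IsFutureCausal.global (hM0 : M < 0) (hJ : |J| < |M|) {x v : Event} (hx : x ∈ bulk M J)
    (hv : IsFutureCausal M J x v) :
    0 ≤ globalTime M J (v 0) (v 2) ∧
    (x 1 + bMinus M J ^ 2) * globalAngle M J (v 0) (v 2) ^ 2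
      + gap M J * v 1 ^ 2 / (4 * ((x 1 + bMinus M J ^ 2) * (x 1 + bPlus M J ^ 2)))
      ≤ (x 1 + bPlus M J ^ 2) * globalTime M J (v 0) (v 2) ^ 2 := by
  obtain ⟨h1, h2⟩ := hv
  have hK := gap_pos hJ
  have hu := inner_pos hx
  have hU := outer_pos hJ hx
  have hUu := outer_eq (M := M) (J := J) x
  have e1 := gap_mul_metricInner hM0 hJ x v v
  have e2 := gap_mul_metricInner hM0 hJ x v (Pi.single 0 1)
  have h1' := mul_nonpos_of_nonneg_of_nonpos hK.le h1
  have h2' := mul_neg_of_pos_of_neg hK h2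
  simp only [globalTime, globalAngle, Pi.single_eq_same, mul_one, ne_eq, Fin.reduceEq,
    not_false_eq_true, Pi.single_eq_of_ne, mul_zero, add_zero, zero_add, zero_div] at e2
  rw [e2] at h2'
  rw [e1] at h1'
  simp only [globalTime, globalAngle] at h1' ⊢
  set T := bPlus M J * v 0 + bMinus M J * v 2
  set A := bPlus M J * v 2 + bMinus M J * v 0
  set u := x 1 + bMinus M J ^ 2
  set U := x 1 + bPlus M J ^ 2
  have hmain : u * A ^ 2 + gap M J * v 1 ^ 2 / (4 * (u * U)) ≤ U * T ^ 2 := by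
    have : gap M J * v 1 * v 1 / (4 * (u * U)) = gap M J * v 1 ^ 2 / (4 * (u * U)) := by ring
    linarith
  refine ⟨?_, hmain⟩
  by_contra! hT
  have hnn : 0 ≤ gap M J * v 1 ^ 2 / (4 * (u * U)) := by positivity
  have hp := bPlus_pos hJ
  have hlt : U * (-T) * bPlus M J < -(u * A * bMinus M J) := by linarith
  have hpos : 0 < U * (-T) * bPlus M J := mul_pos (mul_pos hU (neg_pos.2 hT)) hp
  have hsq : (U * (-T) * bPlus M J) ^ 2 < (u * A * bMinus M J) ^ 2 := by
    rw [← neg_sq (u * A * bMinus M J)]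
    exact pow_lt_pow_left₀ hlt hpos.le two_ne_zero
  have h3 : (u * bMinus M J ^ 2) * (u * A ^ 2) ≤ (u * bMinus M J ^ 2) * (U * T ^ 2) :=
    mul_le_mul_of_nonneg_left (by linarith) (by positivity)
  have hq : bMinus M J ^ 2 ≤ bPlus M J ^ 2 := by unfold gap at hK; linarith
  have h4 : u * bMinus M J ^ 2 ≤ U * bPlus M J ^ 2 :=
    mul_le_mul (by linarith) hq (by positivity) hU.le
  have h5 : (u * bMinus M J ^ 2) * (U * T ^ 2) ≤ (U * bPlus M J ^ 2) * (U * T ^ 2) :=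
    mul_le_mul_of_nonneg_right h4 (by positivity)
  linarith

lemma isFutureCausal_of_global (hM0 : M < 0) (hJ : |J| < |M|) {x v : Event} (hx : x ∈ bulk M J)
    (hT : 0 < globalTime M J (v 0) (v 2))
    (h : (x 1 + bMinus M J ^ 2) * globalAngle M J (v 0) (v 2) ^ 2
      + gap M J * v 1 ^ 2 / (4 * ((x 1 + bMinus M J ^ 2) * (x 1 + bPlus M J ^ 2)))
      ≤ (x 1 + bPlus M J ^ 2) * globalTime M J (v 0) (v 2) ^ 2) :
    IsFutureCausal M J x v := by
  have hK := gap_pos hJ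
  have hu := inner_pos hx
  have hU := outer_pos hJ hx
  have hUu := outer_eq (M := M) (J := J) x
  have e1 := gap_mul_metricInner hM0 hJ x v v
  have e2 := gap_mul_metricInner hM0 hJ x v (Pi.single 0 1)
  simp only [globalTime, globalAngle, Pi.single_eq_same, mul_one, ne_eq, Fin.reduceEq,
    not_false_eq_true, Pi.single_eq_of_ne, mul_zero, add_zero, zero_add, zero_div] at e2
  constructor
  · refine nonpos_of_mul_nonpos_right ?_ hK
    rw [e1]
    have e3 : ∀ y : ℝ, gap M J * v 1 * v 1 / y = gap M J * v 1 ^ 2 / y := fun y => by ring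
    rw [e3]
    linarith
  · refine neg_of_mul_neg_right ?_ hK.le
    rw [e2]
    simp only [globalTime, globalAngle] at h hT
    set T := bPlus M J * v 0 + bMinus M J * v 2
    set A := bPlus M J * v 2 + bMinus M J * v 0
    set u := x 1 + bMinus M J ^ 2
    set U := x 1 + bPlus M J ^ 2
    have hnn : 0 ≤ gap M J * v 1 ^ 2 / (4 * (u * U)) := by positivity
    have hp := bPlus_pos hJ
    have hq : bMinus M J ^ 2 < bPlus M J ^ 2 := by unfold gap at hK; linarith
    have h3 : (u * bMinus M J ^ 2) * (u * A ^ 2) ≤ (u * bMinus M J ^ 2) * (U * T ^ 2) :=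
      mul_le_mul_of_nonneg_left (by linarith) (by positivity)
    have h4 : u * bMinus M J ^ 2 < U * bPlus M J ^ 2 :=
      mul_lt_mul' (by linarith) hq (by positivity) hU
    have h5 : (u * bMinus M J ^ 2) * (U * T ^ 2) < (U * bPlus M J ^ 2) * (U * T ^ 2) :=
      mul_lt_mul_of_pos_right h4 (by positivity)
    have h6 : u * A * bMinus M J < U * T * bPlus M J :=
      lt_of_pow_lt_pow_left₀ 2 (by positivity) (by nlinarith)
    linarith

lemma IsFutureCausal.smul {x v : Event} (h : IsFutureCausal M J x v) {r : ℝ} (hr : 0 < r) :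
    IsFutureCausal M J x (r • v) := by
  have e : ∀ v', metricInner M J x (r • v) v' = r * metricInner M J x v v' := fun v' => by
    simp only [metricInner, Fin.sum_univ_three, Pi.smul_apply, smul_eq_mul]; ring
  have e' : metricInner M J x (r • v) (r • v) = r ^ 2 * metricInner M J x v v := by
    simp only [metricInner, Fin.sum_univ_three, Pi.smul_apply, smul_eq_mul]; ring
  exact ⟨by rw [e']; exact mul_nonpos_of_nonneg_of_nonpos (by positivity) h.1,
    by rw [e]; exact mul_neg_of_pos_of_neg hr h.2⟩

lemma causalFuture_trans {P : BdyPoint} {p q : Event} (hp : p ∈ causalFuture M J P)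
    {c₂ : ℝ → Event} (hc₂ : IsFutureCausalCurve M J c₂ (Set.Icc 0 1)) (h0 : c₂ 0 = p)
    (h1 : c₂ 1 = q) : q ∈ causalFuture M J P := by
  obtain ⟨c₁, ⟨hc, hb, F, hF⟩, hP, hp1⟩ := hp
  obtain ⟨hc', hb', F', hF'⟩ := hc₂
  let c : ℝ → Event := fun s => if s ≤ 1 / 2 then c₁ (2 * s) else c₂ (2 * s - 1)
  -- Both curves are run at double speed; the junction `1/2` is a new possible corner.
  refine ⟨c, ⟨?_, ?_, insert (1 / 2) (F.image (fun s => s / 2) ∪ F'.image (fun s => (s + 1) / 2)),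
    ?_⟩, ?_, ?_⟩
  · refine ContinuousOn.if ?_ ?_ ?_
    · rintro a ⟨-, ha⟩
      have : a = 1 / 2 := by
        have := frontier_Iic_subset _ ha
        simpa using this
      subst this
      norm_num [hp1, h0]
    · refine hc.comp (by fun_prop) ?_
      rintro a ⟨ha, ha'⟩
      have : a ≤ 1 / 2 := by
        have h := closure_minimal (s := {a : ℝ | a ≤ 1 / 2}) (t := Set.Iic (1 / 2))
          (fun _ h => h) isClosed_Iic ha'
        exact h
      exact ⟨by linarith [ha.1], by linarith⟩
    · refine hc'.comp (by fun_prop) ?_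
      rintro a ⟨ha, ha'⟩
      have : 1 / 2 ≤ a := by
        have h := closure_minimal (s := {a : ℝ | ¬ a ≤ 1 / 2}) (t := Set.Ici (1 / 2))
          (fun _ h => (not_le.1 h).le) isClosed_Ici ha'
        exact h
      exact ⟨by linarith, by linarith [ha.2]⟩
  · rintro s ⟨hs0, hs1⟩
    by_cases hs : s ≤ 1 / 2
    · simp only [c, if_pos hs]
      exact hb _ ⟨by linarith, by linarith⟩
    · simp only [c, if_neg hs]
      exact hb' _ ⟨by linarith, by linarith⟩
  · intro s hs hsF
    rw [interior_Ioc] at hs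
    simp only [Finset.mem_insert, Finset.mem_union, Finset.mem_image, not_or, not_exists,
      not_and] at hsF
    rcases lt_or_gt_of_ne hsF.1 with hlt | hgt
    · obtain ⟨v, hv, hvc⟩ := hF (2 * s) (by rw [interior_Ioc]; exact ⟨by linarith [hs.1], by linarith⟩)
        (fun h => hsF.2.1 _ h (by ring))
      refine ⟨(2 : ℝ) • v, ?_, ?_⟩
      · have := hv.scomp s ((hasDerivAt_id' s).const_mul 2)
        rw [mul_one] at this
        refine this.congr_of_eventuallyEq ?_
        filter_upwards [Iio_mem_nhds hlt] with y hy
        exact if_pos (le_of_lt hy)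
      · simp only [c, if_pos hlt.le]
        exact hvc.smul two_pos
    · obtain ⟨v, hv, hvc⟩ := hF' (2 * s - 1)
        (by rw [interior_Icc]; exact ⟨by linarith, by linarith [hs.2]⟩)
        (fun h => hsF.2.2 _ h (by ring))
      refine ⟨(2 : ℝ) • v, ?_, ?_⟩
      · have := hv.scomp s (((hasDerivAt_id' s).const_mul 2).sub_const 1)
        rw [mul_one] at this
        refine this.congr_of_eventuallyEq ?_
        filter_upwards [Ioi_mem_nhds hgt] with y hy
        exact if_neg (not_le.2 hy)
      · simp only [c, if_neg (not_le.2 hgt)]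
        exact hvc.smul two_pos
  · have hlim : Tendsto (fun s : ℝ => 2 * s) (𝓝[>] 0) (𝓝[>] 0) := by
      refine tendsto_nhdsWithin_iff.2 ⟨?_, ?_⟩
      · have : Tendsto (fun s : ℝ => 2 * s) (𝓝 0) (𝓝 (2 * 0)) := tendsto_id.const_mul 2
        rw [mul_zero] at this
        exact this.mono_left nhdsWithin_le_nhds
      · filter_upwards [self_mem_nhdsWithin] with s hs
        exact Set.mem_Ioi.2 (mul_pos two_pos (Set.mem_Ioi.1 hs))
    have hev : ∀ᶠ s : ℝ in 𝓝[>] 0, c₁ (2 * s) = c s := by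
      filter_upwards [nhdsWithin_le_nhds (Iio_mem_nhds (show (0 : ℝ) < 1 / 2 by norm_num))] with s hs
      exact (if_pos (le_of_lt hs)).symm
    refine ⟨(hP.1.comp hlim).congr' ?_, (hP.2.1.comp hlim).congr' ?_, (hP.2.2.comp hlim).congr' ?_⟩
    all_goals
      filter_upwards [hev] with s hs
      simp [hs]
  · norm_num [c, h1]

/-- A scattering point can be pushed forward to the point of `γ` that it precedes, which is then
reached from both boundary points by concatenation. -/
lemma scatteringRegion_nonempty_iff {c₁ c₂ : BdyPoint} {γ : ℝ → Event}
    (hγ : ∀ s, γ s ∈ bulk M J) :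
    (scatteringRegion M J c₁ c₂ γ).Nonempty ↔
      ∃ s, γ s ∈ causalFuture M J c₁ ∧ γ s ∈ causalFuture M J c₂ := by
  constructor
  · rintro ⟨p, ⟨h1, h2⟩, -, q, ⟨s, rfl⟩, rfl | ⟨c, hc, hc0, hc1⟩⟩
    · exact ⟨s, h1, h2⟩
    · exact ⟨s, causalFuture_trans h1 hc hc0 hc1, causalFuture_trans h2 hc hc0 hc1⟩
  · rintro ⟨s, h1, h2⟩
    exact ⟨γ s, ⟨h1, h2⟩, hγ s, γ s, ⟨s, rfl⟩, Or.inl rfl⟩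

/-! ### Points reached from the boundary -/

lemma le_of_deriv_nonneg_off_finset {f : ℝ → ℝ} (F : Finset ℝ) :
    ∀ {a b : ℝ}, a ≤ b → ContinuousOn f (Set.Icc a b) →
    (∀ s ∈ Set.Ioo a b, s ∉ F → ∃ f', HasDerivAt f f' s ∧ 0 ≤ f') → f a ≤ f b := by
  induction F using Finset.induction_on with
  | empty =>
    intro a b hab hc hd
    refine monotoneOn_of_deriv_nonneg (convex_Icc a b) hc ?_ ?_ (Set.left_mem_Icc.2 hab)
      (Set.right_mem_Icc.2 hab) hab
    · rw [interior_Icc]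
      intro s hs
      obtain ⟨f', h, -⟩ := hd s hs (Finset.notMem_empty _)
      exact h.differentiableAt.differentiableWithinAt
    · rw [interior_Icc]
      intro s hs
      obtain ⟨f', h, h'⟩ := hd s hs (Finset.notMem_empty _)
      rwa [h.deriv]
  | insert x F _ ih =>
    intro a b hab hc hd
    by_cases hx : x ∈ Set.Ioo a b
    · refine (ih hx.1.le (hc.mono (Set.Icc_subset_Icc_right hx.2.le)) fun s hs hsF => ?_).trans
        (ih hx.2.le (hc.mono (Set.Icc_subset_Icc_left hx.1.le)) fun s hs hsF => ?_)
      · refine hd s ⟨hs.1, hs.2.trans hx.2⟩ ?_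
        rw [Finset.mem_insert, not_or]
        exact ⟨hs.2.ne, hsF⟩
      · refine hd s ⟨hx.1.trans hs.1, hs.2⟩ ?_
        rw [Finset.mem_insert, not_or]
        exact ⟨hs.1.ne', hsF⟩
    · refine ih hab hc fun s hs hsF => hd s hs ?_
      rw [Finset.mem_insert, not_or]
      exact ⟨fun h => hx (h ▸ hs), hsF⟩

/-- Dividing the metric by `U` leaves `-dT²` plus the round metric of a unit hemisphere with
projected radius `r = √(u/U)` and angle `Φ`; the conformal boundary is the equator. The `arccos` is
the spherical distance to the equator point of angle `A0`, and distance grows no faster than `T`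
along a causal curve. -/
lemma hasDerivAt_time_sub_arccos (hM0 : M < 0) (hJ : |J| < |M|) {c : ℝ → Event} {s : ℝ} {v : Event}
    (hb : c s ∈ bulk M J) (hc : HasDerivAt c v s) (hv : IsFutureCausal M J (c s) v) (A0 : ℝ) :
    ∃ f', HasDerivAt (fun s => globalTime M J (c s 0) (c s 2) -
      Real.arccos (√((c s 1 + bMinus M J ^ 2) / (c s 1 + bPlus M J ^ 2)) *
        Real.cos (globalAngle M J (c s 0) (c s 2) - A0))) f' s ∧ 0 ≤ f' := by
  obtain ⟨hT, hle⟩ := hv.global hM0 hJ hb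
  have hd := hasDerivAt_pi.1 hc
  have hK := gap_pos hJ
  have hu := inner_pos hb
  have hU := outer_pos hJ hb
  have hUu := outer_eq (M := M) (J := J) (c s)
  have dT : HasDerivAt (fun s => globalTime M J (c s 0) (c s 2))
      (globalTime M J (v 0) (v 2)) s := ((hd 0).const_mul _).fun_add ((hd 2).const_mul _)
  have dA : HasDerivAt (fun s => globalAngle M J (c s 0) (c s 2))
      (globalAngle M J (v 0) (v 2)) s := ((hd 2).const_mul _).fun_add ((hd 0).const_mul _)
  have dr := (((hd 1).add_const (bMinus M J ^ 2)).fun_div ((hd 1).add_const (bPlus M J ^ 2))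
    hU.ne').sqrt (div_pos hu hU).ne'
  have dk := dr.fun_mul (dA.sub_const A0).cos
  set T' := globalTime M J (v 0) (v 2)
  set A' := globalAngle M J (v 0) (v 2)
  set u := c s 1 + bMinus M J ^ 2
  set U := c s 1 + bPlus M J ^ 2
  set δ := globalAngle M J (c s 0) (c s 2) - A0
  have hr0 : 0 < √(u / U) := Real.sqrt_pos.2 (div_pos hu hU)
  have hr2 : √(u / U) ^ 2 = u / U := Real.sq_sqrt (div_pos hu hU).le
  set r := √(u / U)
  have hr1 : r ^ 2 = 1 - gap M J / U := by
    rw [hr2, hUu]; field_simp; ring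
  have hKU : 0 < gap M J / U := div_pos hK hU
  have hcos := Real.sin_sq_add_cos_sq δ
  have hk : 1 - (r * Real.cos δ) ^ 2 = Real.sin δ ^ 2 + gap M J / U * Real.cos δ ^ 2 := by
    rw [mul_pow, hr1]; linear_combination -hcos
  have hkpos : 0 < 1 - (r * Real.cos δ) ^ 2 := by
    rw [hk]
    by_cases h : Real.sin δ = 0
    · have : Real.cos δ ^ 2 = 1 := by rw [h] at hcos; linarith
      rw [h, this]; simpa using hKU
    · positivity
  have hk1 : r * Real.cos δ ≠ 1 := fun h => by rw [h] at hkpos; norm_num at hkpos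
  have hk2 : r * Real.cos δ ≠ -1 := fun h => by rw [h] at hkpos; norm_num at hkpos
  have darc := (Real.hasDerivAt_arccos hk2 hk1).comp s dk
  refine ⟨_, dT.fun_sub darc, ?_⟩
  set B := (v 1 * U - u * v 1) / U ^ 2 / (2 * r) with hB
  have hB2 : B ^ 2 = gap M J / U * (gap M J * v 1 ^ 2 / (4 * (u * U))) / U := by
    have : v 1 * U - u * v 1 = gap M J * v 1 := by rw [hUu]; ring
    rw [hB, this, div_pow, mul_pow, hr2]
    field_simp
    ring
  -- This is causality divided by `U`, where `B` is the derivative of `r` and `gap / U = 1 - r²`.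
  have hT2 : (r * A') ^ 2 + B ^ 2 / (gap M J / U) ≤ T' ^ 2 := by
    have e : (r * A') ^ 2 + B ^ 2 / (gap M J / U) =
        (u * A' ^ 2 + gap M J * v 1 ^ 2 / (4 * (u * U))) / U := by
      rw [hB2, mul_pow, hr2]; field_simp
    rw [e, div_le_iff₀ hU]
    linarith
  set e := gap M J / U
  have key : (B * Real.cos δ + r * (-Real.sin δ * A')) ^ 2 ≤
      (T' * √(1 - (r * Real.cos δ) ^ 2)) ^ 2 := by
    rw [mul_pow, Real.sq_sqrt hkpos.le, hk]
    refine le_trans ?_ (mul_le_mul_of_nonneg_right hT2 (by positivity))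
    -- The defect in the Cauchy–Schwarz inequality, written as a multiple of a square.
    have : ((r * A') ^ 2 + B ^ 2 / e) * (Real.sin δ ^ 2 + e * Real.cos δ ^ 2)
        - (B * Real.cos δ + r * (-Real.sin δ * A')) ^ 2
        = e * (r * A' * Real.cos δ + B * Real.sin δ / e) ^ 2 := by
      field_simp; ring
    have h2 : 0 ≤ e * (r * A' * Real.cos δ + B * Real.sin δ / e) ^ 2 := by positivity
    linarith
  have h3 := (abs_le.1 (abs_le_of_sq_le_sq key (by positivity))).1
  have hs := Real.sqrt_pos.2 hkpos
  have e4 : T' - -(1 / √(1 - (r * Real.cos δ) ^ 2)) * (B * Real.cos δ + r * (-Real.sin δ * A'))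
      = (T' * √(1 - (r * Real.cos δ) ^ 2) + (B * Real.cos δ + r * (-Real.sin δ * A')))
        / √(1 - (r * Real.cos δ) ^ 2) := by
    generalize √(1 - (r * Real.cos δ) ^ 2) = Z at hs
    field_simp
    ring
  rw [e4]
  exact div_nonneg (by linarith) hs.le

lemma arccos_le_of_mem_causalFuture (hM0 : M < 0) (hJ : |J| < |M|) {P : BdyPoint} {x : Event}
    (hx : x ∈ causalFuture M J P) :
    Real.arccos (√((x 1 + bMinus M J ^ 2) / (x 1 + bPlus M J ^ 2)) *
        Real.cos (globalAngle M J (x 0) (x 2) - globalAngle M J P.1 P.2)) ≤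
      globalTime M J (x 0) (x 2) - globalTime M J P.1 P.2 := by
  obtain ⟨c, ⟨hc, hb, F, hF⟩, hP, rfl⟩ := hx
  set A0 := globalAngle M J P.1 P.2
  set f : ℝ → ℝ := fun s => globalTime M J (c s 0) (c s 2) -
      Real.arccos (√((c s 1 + bMinus M J ^ 2) / (c s 1 + bPlus M J ^ 2)) *
        Real.cos (globalAngle M J (c s 0) (c s 2) - A0)) with hf
  have hcont : ContinuousOn f (Set.Ioc 0 1) := by
    have hci : ∀ i, ContinuousOn (fun s => c s i) (Set.Ioc 0 1) := continuousOn_pi.1 hc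
    have h0 := hci 0
    have h1 := hci 1
    have h2 := hci 2
    have hdiv : ContinuousOn (fun s => (c s 1 + bMinus M J ^ 2) / (c s 1 + bPlus M J ^ 2))
        (Set.Ioc 0 1) :=
      (h1.add continuousOn_const).div (h1.add continuousOn_const)
        fun s hs => (outer_pos hJ (hb s hs)).ne'
    refine ContinuousOn.sub ((h0.const_mul _).add (h2.const_mul _))
      (Real.continuous_arccos.comp_continuousOn (hdiv.sqrt.mul
        (Real.continuous_cos.comp_continuousOn
          (((h2.const_mul _).add (h0.const_mul _)).sub continuousOn_const))))
  have hmono : ∀ s ∈ Set.Ioc (0 : ℝ) 1, f s ≤ f 1 := fun s hs => by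
    refine le_of_deriv_nonneg_off_finset F hs.2
      (hcont.mono fun y hy => ⟨hs.1.trans_le hy.1, hy.2⟩) fun y hy hyF => ?_
    have hy' : y ∈ Set.Ioo (0 : ℝ) 1 := ⟨hs.1.trans hy.1, hy.2⟩
    obtain ⟨v, hv, hvc⟩ := hF y (by rwa [interior_Ioc]) hyF
    exact hasDerivAt_time_sub_arccos hM0 hJ (hb y ⟨hy'.1, hy'.2.le⟩) hv hvc A0
  -- Towards `P` the radius `√(u/U)` tends to `1` and the angle difference to `0`, so the distance
  -- term vanishes.
  have hlim : Tendsto f (𝓝[>] 0) (𝓝 (globalTime M J P.1 P.2)) := by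
    have h1 : Tendsto (fun s => (c s 1 + bMinus M J ^ 2) / (c s 1 + bPlus M J ^ 2)) (𝓝[>] 0)
        (𝓝 1) := by
      have h2 : Tendsto (fun s => c s 1 + bPlus M J ^ 2) (𝓝[>] 0) atTop :=
        tendsto_atTop_add_const_right _ _ hP.2.1
      have h3 := ((h2.const_div_atTop (gap M J)).const_sub 1)
      rw [sub_zero] at h3
      refine h3.congr' ?_
      filter_upwards [h2.eventually_gt_atTop 0] with s hs
      have := outer_eq (M := M) (J := J) (c s)
      rw [eq_div_iff hs.ne', sub_mul, div_mul_cancel₀ _ hs.ne']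
      linarith
    have h4 := h1.sqrt.mul ((Real.continuous_cos.tendsto _).comp
      ((hP.globalAngle (M := M) (J := J)).sub_const A0))
    rw [sub_self, Real.cos_zero, Real.sqrt_one, mul_one] at h4
    have h5 := (hP.globalTime (M := M) (J := J)).sub ((Real.continuous_arccos.tendsto _).comp h4)
    rwa [Real.arccos_one, sub_zero] at h5
  have := le_of_tendsto hlim (by
    filter_upwards [Ioc_mem_nhdsGT (zero_lt_one (α := ℝ))] with s hs using hmono s hs)
  simp only [hf] at this
  linarith

/-- The angle along a line `h = const` in the `Φ` plane. The complex argument stays smooth when `X`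
changes sign with `h ≠ 0`, where `arctan (h / X)` would jump. -/
lemma hasDerivAt_arg_ofReal_add_mul_I {X : ℝ → ℝ} {X' s h : ℝ} (hX : HasDerivAt X X' s)
    (hs : 0 < X s ∨ h ≠ 0) :
    HasDerivAt (fun s => Complex.arg (X s + h * Complex.I)) (-h * X' / (X s ^ 2 + h ^ 2)) s := by
  have hslit : (X s : ℂ) + h * Complex.I ∈ Complex.slitPlane := by
    rw [Complex.mem_slitPlane_iff]
    simpa using hs
  have hne : X s ^ 2 + h ^ 2 ≠ 0 := by
    rcases hs with hs | hs <;> positivity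
  have h1 := (hX.ofReal_comp.add_const ((h : ℂ) * Complex.I)).clog_real hslit
  have h2 := Complex.imCLM.hasFDerivAt.comp_hasDerivAt s h1
  have e : (⇑Complex.imCLM ∘ fun t => Complex.log ((X t : ℂ) + h * Complex.I)) =
      fun s => Complex.arg (X s + h * Complex.I) := by
    ext t; exact Complex.log_im _
  rw [← e]
  refine h2.congr_deriv ?_
  simp [Complex.div_im, Complex.normSq_apply]
  field_simp

lemma tendsto_arg_ofReal_add_mul_I {X : ℝ → ℝ} {l : Filter ℝ} (hX : Tendsto X l atTop) (h : ℝ) :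
    Tendsto (fun s => Complex.arg (X s + h * Complex.I)) l (𝓝 0) := by
  have h1 : Tendsto (fun s => (1 : ℂ) + ((h / X s : ℝ) : ℂ) * Complex.I) l (𝓝 1) := by
    have := (((Complex.continuous_ofReal.tendsto 0).comp (hX.const_div_atTop h)).mul_const
      Complex.I).const_add 1
    simpa using this
  have h2 := (Complex.continuousAt_arg Complex.one_mem_slitPlane).tendsto.comp h1
  rw [Complex.arg_one] at h2
  refine h2.congr' ?_
  filter_upwards [hX.eventually_gt_atTop 0] with s hs
  have hne : (X s : ℂ) ≠ 0 := by exact_mod_cast hs.ne'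
  rw [Function.comp_apply, ← Complex.arg_real_mul _ hs]
  congr 1
  push_cast
  field_simp

lemma sqrt_mul_cos_pi_div_two_sub_arctan {X H : ℝ} (hH : 0 < H) :
    √(X ^ 2 + H ^ 2) * Real.cos (Real.pi / 2 - Real.arctan (X / H)) = X := by
  have h1 : √(1 + (X / H) ^ 2) = √(X ^ 2 + H ^ 2) / H := by
    rw [show 1 + (X / H) ^ 2 = (X ^ 2 + H ^ 2) / H ^ 2 by field_simp; ring,
      Real.sqrt_div' _ (by positivity), Real.sqrt_sq hH.le]
  have h2 : 0 < √(X ^ 2 + H ^ 2) := Real.sqrt_pos.2 (by positivity)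
  rw [Real.cos_pi_div_two_sub, Real.sin_arctan, h1]
  field_simp

/-- A point at or above the light cone of `P`, at an angle less than `π` from `P`, is reached from
`P` along the line `√u sin (Φ - Φ(P)) = const` of the embedding space. -/
lemma mem_causalFuture_of_le (hM0 : M < 0) (hJ : |J| < |M|) {P : BdyPoint} {x : Event}
    (hx : x ∈ bulk M J)
    (hA : |globalAngle M J (x 0) (x 2) - globalAngle M J P.1 P.2| < Real.pi)
    (hT0 : 0 ≤ globalTime M J (x 0) (x 2) - globalTime M J P.1 P.2)
    (hT1 : globalTime M J (x 0) (x 2) - globalTime M J P.1 P.2 ≤ Real.pi)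
    (hle : √(x 1 + bPlus M J ^ 2)
        * Real.cos (globalTime M J (x 0) (x 2) - globalTime M J P.1 P.2) ≤
      √(x 1 + bMinus M J ^ 2)
        * Real.cos (globalAngle M J (x 0) (x 2) - globalAngle M J P.1 P.2)) :
    x ∈ causalFuture M J P := by
  have hK := gap_pos hJ
  have hu := inner_pos hx
  have hU := outer_pos hJ hx
  have hUu := outer_eq (M := M) (J := J) x
  set δ := globalAngle M J (x 0) (x 2) - globalAngle M J P.1 P.2 with hδ
  set τ := globalTime M J (x 0) (x 2) - globalTime M J P.1 P.2 with hτ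
  obtain ⟨hA1, hA2⟩ := abs_lt.1 hA
  set u := x 1 + bMinus M J ^ 2 with hudef
  set U := x 1 + bPlus M J ^ 2 with hUdef
  have hru := Real.sqrt_pos.2 hu
  have hru2 := Real.sq_sqrt hu.le
  set X0 := √u * Real.cos δ with hX0
  set h := √u * Real.sin δ with hh
  have hX0h : X0 ^ 2 + h ^ 2 = u := by
    rw [hX0, hh]
    linear_combination hru2 + √u ^ 2 * Real.sin_sq_add_cos_sq δ
  set H := √(gap M J + h ^ 2) with hH
  have hHpos : 0 < H := Real.sqrt_pos.2 (by positivity)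
  have hH2 : H ^ 2 = gap M J + h ^ 2 := Real.sq_sqrt (by positivity)
  -- The arrival time of the light ray from `P` along the line `h = const`: here `U = X0² + H²` and
  -- `cos τ₀ = X0 / √U`, so `hle` says `τ₀ ≤ τ`.
  set τ₀ := Real.pi / 2 - Real.arctan (X0 / H) with hτ₀
  have hτ₀pos : 0 < τ₀ := by linarith [Real.arctan_lt_pi_div_two (X0 / H)]
  have hτ₀pi : τ₀ ≤ Real.pi := by linarith [Real.neg_pi_div_two_lt_arctan (X0 / H)]
  have hττ₀ : τ₀ ≤ τ := by
    rw [← Real.strictAntiOn_cos.le_iff_ge ⟨hT0, hT1⟩ ⟨hτ₀pos.le, hτ₀pi⟩]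
    refine le_of_mul_le_mul_left (hle.trans_eq ?_) (Real.sqrt_pos.2 hU)
    rw [show U = X0 ^ 2 + H ^ 2 by rw [hUu, hH2]; linarith,
      sqrt_mul_cos_pi_div_two_sub_arctan hHpos]
  -- Stretching the time along the light ray by `κ ≥ 1` keeps the curve causal and makes it arrive
  -- exactly at `x`.
  set κ := τ / τ₀ with hκ
  have hκ1 : 1 ≤ κ := (one_le_div hτ₀pos).2 hττ₀
  have hκτ : κ * τ₀ = τ := div_mul_cancel₀ _ hτ₀pos.ne'
  set p := bPlus M J with hp
  set q := bMinus M J with hq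
  -- The coordinate `√u cos(Φ - Φ(P))` along the line: infinite at `s = 0`, equal to `X0` at `s =
  -- 1`.
  let X : ℝ → ℝ := fun s => X0 + (s⁻¹ - 1)
  let T : ℝ → ℝ := fun s => globalTime M J P.1 P.2 + κ * (Real.pi / 2 - Real.arctan (X s / H))
  let A : ℝ → ℝ := fun s => globalAngle M J P.1 P.2 + Complex.arg (X s + h * Complex.I)
  let c : ℝ → Event := fun s => ![(p * T s - q * A s) / gap M J, X s ^ 2 + h ^ 2 - q ^ 2,
    (p * A s - q * T s) / gap M J]
  -- The line must miss the defect `u = 0`. If `h = 0`, then `|δ| < π` leaves only `δ = 0`, and the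
  -- line stays on the positive axis.
  have hslit : ∀ s ∈ Set.Ioc (0 : ℝ) 1, 0 < X s ∨ h ≠ 0 := by
    intro s hs
    by_cases h0 : h = 0
    · left
      have hs0 : Real.sin δ = 0 := by
        rcases mul_eq_zero.1 h0 with h1 | h1
        · exact absurd h1 hru.ne'
        · exact h1
      have hδ0 : δ = 0 := (Real.sin_eq_zero_iff_of_lt_of_lt hA1 hA2).1 hs0
      have : 1 ≤ s⁻¹ := (one_le_inv₀ hs.1).2 hs.2
      have hX0' : X0 = √u := by rw [hX0, hδ0, Real.cos_zero, mul_one]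
      simp only [X]
      linarith
    · exact Or.inr h0
  have dX : ∀ s ∈ Set.Ioc (0 : ℝ) 1, HasDerivAt X (-(s ^ 2)⁻¹) s := fun s hs =>
    ((hasDerivAt_inv hs.1.ne').sub_const 1).const_add X0
  let T1 : ℝ → ℝ := fun s => κ * (H / (X s ^ 2 + H ^ 2)) * (s ^ 2)⁻¹
  let A1 : ℝ → ℝ := fun s => h / (X s ^ 2 + h ^ 2) * (s ^ 2)⁻¹
  have dT : ∀ s ∈ Set.Ioc (0 : ℝ) 1, HasDerivAt T (T1 s) s := fun s hs => by
    refine (((((dX s hs).div_const H).arctan.const_sub (Real.pi / 2)).const_mul κ).const_add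
      (globalTime M J P.1 P.2)).congr_deriv ?_
    have := hs.1
    simp only [T1]
    rw [show 1 + (X s / H) ^ 2 = (X s ^ 2 + H ^ 2) / H ^ 2 by field_simp; ring]
    field_simp
  have dA : ∀ s ∈ Set.Ioc (0 : ℝ) 1, HasDerivAt A (A1 s) s := fun s hs => by
    refine ((hasDerivAt_arg_ofReal_add_mul_I (dX s hs) (hslit s hs)).const_add
      (globalAngle M J P.1 P.2)).congr_deriv ?_
    simp only [A1]
    ring
  let v : ℝ → Event := fun s => ![(p * T1 s - q * A1 s) / gap M J, 2 * X s * (-(s ^ 2)⁻¹),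
    (p * A1 s - q * T1 s) / gap M J]
  have dc : ∀ s ∈ Set.Ioc (0 : ℝ) 1, HasDerivAt c (v s) s := fun s hs => by
    refine hasDerivAt_pi.2 fun i => ?_
    fin_cases i
    · exact (((dT s hs).const_mul p).fun_sub ((dA s hs).const_mul q)).div_const _
    · exact ((((dX s hs).fun_pow 2).add_const (h ^ 2)).sub_const (q ^ 2)).congr_deriv
        (by simp [v])
    · exact (((dA s hs).const_mul p).fun_sub ((dT s hs).const_mul q)).div_const _
  have hXh : ∀ s ∈ Set.Ioc (0 : ℝ) 1, 0 < X s ^ 2 + h ^ 2 := fun s hs => by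
    rcases hslit s hs with h1 | h1 <;> positivity
  have hcu : ∀ s, c s 1 + q ^ 2 = X s ^ 2 + h ^ 2 := fun s => by simp [c]
  have hcU : ∀ s, c s 1 + p ^ 2 = X s ^ 2 + H ^ 2 := fun s => by
    rw [outer_eq, hcu, hH2]; ring
  have hcb : ∀ s ∈ Set.Ioc (0 : ℝ) 1, c s ∈ bulk M J := fun s hs => by
    have h1 := hXh s hs
    have h2 := hcu s
    change -q ^ 2 < c s 1
    linarith
  have hXtop : Tendsto X (𝓝[>] 0) atTop :=
    tendsto_atTop_add_const_left _ _ (tendsto_atTop_add_const_right _ _ tendsto_inv_nhdsGT_zero)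
  have hTlim : Tendsto T (𝓝[>] 0) (𝓝 (globalTime M J P.1 P.2)) := by
    have h1 : Tendsto (fun s => Real.arctan (X s / H)) (𝓝[>] 0) (𝓝 (Real.pi / 2)) :=
      tendsto_nhds_of_tendsto_nhdsWithin
        (Real.tendsto_arctan_atTop.comp (hXtop.atTop_div_const hHpos))
    have h2 := ((h1.const_sub (Real.pi / 2)).const_mul κ).const_add (globalTime M J P.1 P.2)
    rwa [sub_self, mul_zero, add_zero] at h2
  have hAlim : Tendsto A (𝓝[>] 0) (𝓝 (globalAngle M J P.1 P.2)) := by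
    have h2 := (tendsto_arg_ofReal_add_mul_I hXtop h).const_add (globalAngle M J P.1 P.2)
    rwa [add_zero] at h2
  refine ⟨c, ⟨fun s hs => (dc s hs).continuousAt.continuousWithinAt, hcb, ∅, fun s hs _ => ?_⟩,
    ⟨?_, ?_, ?_⟩, ?_⟩
  · rw [interior_Ioc] at hs
    have hs' : s ∈ Set.Ioc (0 : ℝ) 1 := ⟨hs.1, hs.2.le⟩
    refine ⟨v s, dc s hs', isFutureCausal_of_global hM0 hJ (hcb s hs') ?_ ?_⟩
    · rw [show globalTime M J (v s 0) (v s 2) = T1 s from globalTime_div_gap hJ _ _]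
      have := hs.1
      simp only [T1]
      positivity
    · rw [show globalTime M J (v s 0) (v s 2) = T1 s from globalTime_div_gap hJ _ _,
        show globalAngle M J (v s 0) (v s 2) = A1 s from globalAngle_div_gap hJ _ _, hcu, hcU]
      have h1 := hXh s hs'
      have h2 : 0 < X s ^ 2 + H ^ 2 := by positivity
      have h3 := hs.1
      have e1 : (X s ^ 2 + h ^ 2) * A1 s ^ 2 + gap M J * v s 1 ^ 2 /
          (4 * ((X s ^ 2 + h ^ 2) * (X s ^ 2 + H ^ 2))) =
          1 * (H ^ 2 / (X s ^ 2 + H ^ 2) * ((s ^ 2)⁻¹) ^ 2) := by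
        have hv1 : v s 1 = 2 * X s * (-(s ^ 2)⁻¹) := rfl
        rw [hv1, show gap M J = H ^ 2 - h ^ 2 by linarith]
        simp only [A1]
        field_simp
        ring
      have e2 : (X s ^ 2 + H ^ 2) * T1 s ^ 2 =
          κ ^ 2 * (H ^ 2 / (X s ^ 2 + H ^ 2) * ((s ^ 2)⁻¹) ^ 2) := by
        simp only [T1]
        field_simp
      rw [e1, e2]
      refine mul_le_mul_of_nonneg_right (one_le_pow₀ hκ1) (by positivity)
  · rw [time_eq_of_global hJ P.1 P.2]
    exact ((hTlim.const_mul p).sub (hAlim.const_mul q)).div_const _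
  · exact tendsto_atTop_add_const_right _ _ (tendsto_atTop_add_const_right _ _
      ((tendsto_pow_atTop two_ne_zero).comp hXtop))
  · rw [angle_eq_of_global hJ P.1 P.2]
    exact ((hAlim.const_mul p).sub (hTlim.const_mul q)).div_const _
  · have hX1 : X 1 = X0 := by simp [X]
    have hTx : T 1 = globalTime M J (x 0) (x 2) := by
      simp only [T, hX1]
      rw [← hτ₀, hκτ]
      linarith
    have hAx : A 1 = globalAngle M J (x 0) (x 2) := by
      simp only [A, hX1]
      have : ((X0 : ℝ) : ℂ) + (h : ℂ) * Complex.I =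
          ((√u : ℝ) : ℂ) * (Complex.cos δ + Complex.sin δ * Complex.I) := by
        rw [hX0, hh]
        push_cast
        ring
      rw [this, Complex.arg_mul_cos_add_sin_mul_I hru ⟨hA1, hA2.le⟩]
      linarith
    ext i
    fin_cases i
    · change (p * T 1 - q * A 1) / gap M J = x 0
      rw [hTx, hAx]
      exact (time_eq_of_global hJ _ _).symm
    · change X 1 ^ 2 + h ^ 2 - q ^ 2 = x 1
      rw [hX1, hX0h]
      simp [hudef]
    · change (p * A 1 - q * T 1) / gap M J = x 2
      rw [hTx, hAx]
      exact (angle_eq_of_global hJ _ _).symm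

/-! ### Points of a geodesic reached from the boundary -/

lemma IsExtremalCurve.continuous {P Q : BdyPoint} {γ : ℝ → Event}
    (hγ : IsExtremalCurve M J P Q γ) (i : Fin 3) : Continuous fun s => γ s i :=
  (continuous_apply i).comp hγ.1.1.continuous

/-- The cosine of the distance bound, multiplied by `√U`; the time difference must be at most `π`
for the cosine to reverse the inequality. -/
lemma light_cone_le_of_mem_causalFuture (hM0 : M < 0) (hJ : |J| < |M|) {P : BdyPoint} {x : Event}
    (hxb : x ∈ bulk M J) (hx : x ∈ causalFuture M J P)
    (hT : globalTime M J (x 0) (x 2) - globalTime M J P.1 P.2 ≤ Real.pi) :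
    √(x 1 + bPlus M J ^ 2)
        * Real.cos (globalTime M J (x 0) (x 2) - globalTime M J P.1 P.2) ≤
      √(x 1 + bMinus M J ^ 2)
        * Real.cos (globalAngle M J (x 0) (x 2) - globalAngle M J P.1 P.2) := by
  have hu := inner_pos hxb
  have hU := outer_pos hJ hxb
  have hUu := outer_eq (M := M) (J := J) x
  have hK := gap_pos hJ
  have h := arccos_le_of_mem_causalFuture hM0 hJ hx
  set δ := globalAngle M J (x 0) (x 2) - globalAngle M J P.1 P.2
  set u := x 1 + bMinus M J ^ 2
  set U := x 1 + bPlus M J ^ 2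
  have hr : √(u / U) ≤ 1 := Real.sqrt_le_one.2 ((div_le_one hU).2 (by linarith))
  have hr0 := Real.sqrt_nonneg (u / U)
  have hk : |√(u / U) * Real.cos δ| ≤ 1 := by
    rw [abs_mul, abs_of_nonneg hr0]
    exact mul_le_one₀ hr (abs_nonneg _) (Real.abs_cos_le_one δ)
  obtain ⟨hk1, hk2⟩ := abs_le.1 hk
  have hcos := Real.cos_le_cos_of_nonneg_of_le_pi (Real.arccos_nonneg _) hT h
  rw [Real.cos_arccos hk1 hk2] at hcos
  refine (mul_le_mul_of_nonneg_left hcos (Real.sqrt_nonneg U)).trans_eq ?_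
  have hsU := Real.sqrt_pos.2 hU
  rw [Real.sqrt_div hu.le]
  field_simp

/-- A connected piece of a geodesic that stays on or inside the double light cone of `c` and starts
in the future of `c` lies in the future of `c`. -/
lemma IsExtremalCurve.mem_causalFuture (hM0 : M < 0) (hJ : |J| < |M|) {P Q c : BdyPoint}
    {γ : ℝ → Event} (hγ : IsExtremalCurve M J P Q γ)
    (hT : ∀ s, globalTime M J (γ s 0) (γ s 2) - globalTime M J c.1 c.2 ≤ Real.pi)
    (hA : ∀ s, |globalAngle M J (γ s 0) (γ s 2) - globalAngle M J c.1 c.2| < Real.pi)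
    {S : Set ℝ} (hS : IsPreconnected S)
    (hle : ∀ s ∈ S, √(γ s 1 + bPlus M J ^ 2)
        * Real.cos (globalTime M J (γ s 0) (γ s 2) - globalTime M J c.1 c.2) ≤
      √(γ s 1 + bMinus M J ^ 2)
        * Real.cos (globalAngle M J (γ s 0) (γ s 2) - globalAngle M J c.1 c.2))
    (hpos : ∃ s ∈ S, 0 < globalTime M J (γ s 0) (γ s 2) - globalTime M J c.1 c.2)
    {s : ℝ} (hs : s ∈ S) : γ s ∈ causalFuture M J c := by
  have hK := gap_pos hJ
  refine mem_causalFuture_of_le hM0 hJ (hγ.1.2.1 s) (hA s) ?_ (hT s) (hle s hs)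
  -- The cone inequality alone does not separate future from past. A sign change of the time
  -- difference on `S` would give a point where it vanishes, and there the inequality reads `√U ≤ √u
  -- cos(…)`, contradicting `u < U`.
  by_contra! hneg
  obtain ⟨s', hs', hpos'⟩ := hpos
  have hcont : Continuous fun s => globalTime M J (γ s 0) (γ s 2) - globalTime M J c.1 c.2 :=
    (((hγ.continuous 0).const_mul _).add ((hγ.continuous 2).const_mul _)).sub continuous_const
  obtain ⟨y, hy, hy0⟩ := hS.intermediate_value hs hs' hcont.continuousOn ⟨hneg.le, hpos'.le⟩
  have h1 := hle y hy
  simp only at hy0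
  rw [hy0, Real.cos_zero, mul_one] at h1
  have hu := inner_pos (hγ.1.2.1 y)
  have h2 : √(γ y 1 + bMinus M J ^ 2) < √(γ y 1 + bPlus M J ^ 2) := by
    refine Real.sqrt_lt_sqrt hu.le ?_
    rw [outer_eq (M := M) (J := J)]
    linarith
  have h3 : √(γ y 1 + bMinus M J ^ 2)
      * Real.cos (globalAngle M J (γ y 0) (γ y 2) - globalAngle M J c.1 c.2)
      ≤ √(γ y 1 + bMinus M J ^ 2) :=
    mul_le_of_le_one_right (Real.sqrt_nonneg _) (Real.cos_le_one _)
  linarith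

lemma exists_exp_bounds_iff {a b n q₁ q₂ : ℝ} (ha : 0 < a) (hb : 0 < b) (hn : 0 < n)
    (hq₁ : 0 < q₁) (hq₂ : 0 < q₂) :
    (∃ s, a * Real.exp s * q₁ ≤ b * Real.exp (-s) * n ∧
      b * Real.exp (-s) * q₂ ≤ a * Real.exp s * n) ↔ q₁ * q₂ ≤ n ^ 2 := by
  constructor
  · rintro ⟨s, h1, h2⟩
    have h3 := mul_le_mul h1 h2 (by positivity) (by positivity)
    have h4 : 0 < a * Real.exp s * (b * Real.exp (-s)) := by positivity
    refine le_of_mul_le_mul_left ?_ h4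
    linarith
  · intro h
    -- This `s` turns the first inequality into an equality; in the forward direction the product of
    -- the two inequalities is free of `s`.
    refine ⟨Real.log (b * n / (a * q₁)) / 2, ?_⟩
    set s := Real.log (b * n / (a * q₁)) / 2 with hs
    have h1 : Real.exp s * Real.exp s = b * n / (a * q₁) := by
      rw [← Real.exp_add, hs, add_halves, Real.exp_log (by positivity)]
    have h2 : Real.exp (-s) = (Real.exp s)⁻¹ := Real.exp_neg s
    have h3 := Real.exp_pos s
    have h4 : Real.exp s = b * n / (a * q₁) * Real.exp (-s) := by
      rw [h2, ← h1]; field_simp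
    have h5 := Real.exp_pos (-s)
    constructor
    · rw [h4]
      refine le_of_eq ?_
      field_simp
    · rw [h4]
      have : a * (b * n / (a * q₁) * Real.exp (-s)) * n = b * Real.exp (-s) * (n ^ 2 / q₁) := by
        field_simp
      rw [this]
      refine mul_le_mul_of_nonneg_left ?_ (by positivity)
      rw [le_div_iff₀ hq₁]
      linarith

/-! ### The sine condition -/

lemma sin_add_mul_sin_sub (x y : ℝ) :
    Real.sin (x + y) * Real.sin (x - y) = Real.sin x ^ 2 - Real.sin y ^ 2 := by
  rw [Real.sin_add, Real.sin_sub]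
  linear_combination Real.sin x ^ 2 * Real.sin_sq_add_cos_sq y
    - Real.sin y ^ 2 * Real.sin_sq_add_cos_sq x

lemma cos_sub_cos_eq (x y : ℝ) :
    Real.cos (x - y) - Real.cos (x + y) = 2 * (Real.sin x * Real.sin y) := by
  rw [Real.cos_sub, Real.cos_add]; ring

/-- After clearing denominators, each factor `sin(θ + x) sin(θ - x)`, suitably scaled, is a
difference of squared sines. In the expanded product the terms in `x` alone cancel against the right
side. -/
lemma sineCondition_iff {θ x : ℝ}
    (h1 : Real.sin ((bPlus M J - bMinus M J) / 2 * θ) ≠ 0)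
    (h2 : Real.sin ((bPlus M J + bMinus M J) / 2 * θ) ≠ 0) :
    SineCondition M J θ x ↔
      Real.sin ((bPlus M J + bMinus M J) / 2 * (θ + x))
        * Real.sin ((bPlus M J - bMinus M J) / 2 * (θ + x))
      * (Real.sin ((bPlus M J + bMinus M J) / 2 * (θ - x))
        * Real.sin ((bPlus M J - bMinus M J) / 2 * (θ - x))) ≤
      (Real.sin ((bPlus M J + bMinus M J) / 2 * x)
        * Real.sin ((bPlus M J - bMinus M J) / 2 * x)) ^ 2 := by
  have e1 := sin_add_mul_sin_sub ((bPlus M J + bMinus M J) / 2 * θ)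
    ((bPlus M J + bMinus M J) / 2 * x)
  have e2 := sin_add_mul_sin_sub ((bPlus M J - bMinus M J) / 2 * θ)
    ((bPlus M J - bMinus M J) / 2 * x)
  rw [← mul_add, ← mul_sub] at e1 e2
  rw [mul_mul_mul_comm, e1, e2, SineCondition, ge_iff_le,
    div_add_div _ _ (pow_ne_zero 2 h1) (pow_ne_zero 2 h2), one_le_div (by positivity)]
  constructor <;> intro h <;> linarith

lemma sin_mul_pos {β y : ℝ} (hβ : 0 < β) (hβ1 : β ≤ 1) (hy : 0 < y) (hy' : y < 2 * Real.pi) :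
    0 < Real.sin (β / 2 * y) :=
  Real.sin_pos_of_pos_of_lt_pi (by positivity) (by nlinarith)

lemma isExtremalLength (hM0 : M < 0) (hJ : |J| < |M|) {P Q : BdyPoint} {δ : ℝ} (hδ : 0 < δ)
    (hδ' : bPlus M J * δ < Real.pi) (h1 : Q.1 = P.1) (h2 : Q.2 = P.2 + δ) :
    IsExtremalLength M J P Q (Real.log (2 * (2 *
      (Real.sin ((bPlus M J + bMinus M J) / 2 * δ) * Real.sin ((bPlus M J - bMinus M J) / 2 * δ))))
      - Real.log (gap M J)) := by
  obtain ⟨t, φ⟩ := P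
  obtain ⟨t', φ'⟩ := Q
  simp only at h1 h2
  subst h1 h2
  refine ⟨exists_isExtremalCurve hM0 hJ _ φ hδ hδ', fun γ hγ => ?_⟩
  have h := hγ.hasRenLength hM0 hJ
  rw [← cos_sub_cos_eq]
  convert h using 6
  · unfold globalTime; ring
  · unfold globalAngle; ring

lemma lengths_le_iff {K n₁ n₂ n : ℝ} (h₁ : 0 < n₁) (h₂ : 0 < n₂) (h : 0 < n) :
    (Real.log (2 * (2 * n₁)) - Real.log K) + (Real.log (2 * (2 * n₂)) - Real.log K) ≤
      (Real.log (2 * (2 * n)) - Real.log K) + (Real.log (2 * (2 * n)) - Real.log K) ↔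
    n₁ * n₂ ≤ n ^ 2 := by
  have e : ∀ y : ℝ, 0 < y → Real.log (2 * (2 * y)) = Real.log 4 + Real.log y := fun y hy => by
    rw [← mul_assoc, show (2 : ℝ) * 2 = 4 by norm_num, Real.log_mul (by norm_num) hy.ne']
  rw [e _ h₁, e _ h₂, e _ h, ← Real.log_le_log_iff (mul_pos h₁ h₂) (pow_pos h 2),
    Real.log_mul h₁.ne' h₂.ne', Real.log_pow]
  push_cast
  constructor <;> intro h <;> linarith

lemma scattering_iff (hM0 : M < 0) (hJ : |J| < |M|) (hJ1 : |J| ≤ 1 - |M|) {θ x : ℝ}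
    (hx : 0 < x) (hxθ : x < θ) (hθ : θ < Real.pi) {γ : ℝ → Event}
    (hγ : IsExtremalCurve M J (inputOne θ x).futureTip (inputTwo θ x).futureTip γ) :
    (scatteringRegion M J (inputOne θ x).pastTip (inputTwo θ x).pastTip γ).Nonempty ↔
      SineCondition M J θ x := by
  have hp := bPlus_add_bMinus_pos hJ
  have hm := bPlus_sub_bMinus_pos hJ
  have hp1 := bPlus_add_bMinus_le_one hJ hJ1
  have hm1 := bPlus_sub_bMinus_le_one hJ hJ1
  have hb0 := bPlus_pos hJ
  obtain ⟨a, ha, b, hb, hTe, hAe, -, hTu, hAu⟩ := hγ.embedding hM0 hJ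
  have limP := hγ.2.1.globalTime (M := M) (J := J)
  have limQ := hγ.2.2.globalTime (M := M) (J := J)
  set p := bPlus M J with hpdef
  set q := bMinus M J with hqdef
  have TP : globalTime M J (inputOne θ x).futureTip.1 (inputOne θ x).futureTip.2 =
      p * (θ / 2) - q * (θ / 2) := by
    simp only [globalTime, inputOne, BdyInterval.futureTip]; ring
  have TQ : globalTime M J (inputTwo θ x).futureTip.1 (inputTwo θ x).futureTip.2 =
      p * (θ / 2) + q * (θ / 2) := by
    simp only [globalTime, inputTwo, BdyInterval.futureTip]; ring
  have AP : globalAngle M J (inputOne θ x).futureTip.1 (inputOne θ x).futureTip.2 =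
      -p * (θ / 2) + q * (θ / 2) := by
    simp only [globalAngle, inputOne, BdyInterval.futureTip]; ring
  have AQ : globalAngle M J (inputTwo θ x).futureTip.1 (inputTwo θ x).futureTip.2 =
      p * (θ / 2) + q * (θ / 2) := by
    simp only [globalAngle, inputTwo, BdyInterval.futureTip]; ring
  have T1 : globalTime M J (inputOne θ x).pastTip.1 (inputOne θ x).pastTip.2 =
      p * (θ / 2 - x) - q * (θ / 2) := by
    simp only [globalTime, inputOne, BdyInterval.pastTip]; ring
  have T2 : globalTime M J (inputTwo θ x).pastTip.1 (inputTwo θ x).pastTip.2 =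
      p * (θ / 2 - x) + q * (θ / 2) := by
    simp only [globalTime, inputTwo, BdyInterval.pastTip]; ring
  have A1 : globalAngle M J (inputOne θ x).pastTip.1 (inputOne θ x).pastTip.2 =
      -p * (θ / 2) + q * (θ / 2 - x) := by
    simp only [globalAngle, inputOne, BdyInterval.pastTip]; ring
  have A2 : globalAngle M J (inputTwo θ x).pastTip.1 (inputTwo θ x).pastTip.2 =
      p * (θ / 2) + q * (θ / 2 - x) := by
    simp only [globalAngle, inputTwo, BdyInterval.pastTip]; ring
  rw [TP, TQ] at hTe hTu
  rw [AP, AQ] at hAe hAu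
  rw [TP] at limP
  rw [TQ] at limQ
  -- Half of `cos ΔΦ - cos ΔT` between `cᵢ` and the future tip `bᵢ` above it. Next, `q₁` and `q₂`
  -- are half of `cos ΔT - cos ΔΦ` for `c₁, b₂` and for `c₂, b₁`.
  set n := Real.sin ((p + q) / 2 * x) * Real.sin ((p - q) / 2 * x) with hn
  set q₁ := Real.sin ((p + q) / 2 * (θ + x)) * Real.sin ((p - q) / 2 * (θ - x)) with hq₁
  set q₂ := Real.sin ((p + q) / 2 * (θ - x)) * Real.sin ((p - q) / 2 * (θ + x)) with hq₂
  have hn0 : 0 < n := mul_pos (sin_mul_pos hp hp1 hx (by linarith))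
    (sin_mul_pos hm hm1 hx (by linarith))
  have hq₁0 : 0 < q₁ := mul_pos (sin_mul_pos hp hp1 (by linarith) (by linarith))
    (sin_mul_pos hm hm1 (by linarith) (by linarith))
  have hq₂0 : 0 < q₂ := mul_pos (sin_mul_pos hp hp1 (by linarith) (by linarith))
    (sin_mul_pos hm hm1 (by linarith) (by linarith))
  have en : Real.cos (q * x) - Real.cos (p * x) = 2 * n := by
    rw [hn, ← cos_sub_cos_eq]; congr 2 <;> ring
  have e₁ : Real.cos (p * x + q * θ) - Real.cos (p * θ + q * x) = 2 * q₁ := by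
    rw [hq₁, ← cos_sub_cos_eq]; congr 2 <;> ring
  have e₂ : Real.cos (p * x - q * θ) - Real.cos (-p * θ + q * x) = 2 * q₂ := by
    rw [hq₂, ← cos_sub_cos_eq, ← Real.cos_neg, ← Real.cos_neg (-p * θ + q * x)]
    congr 2 <;> ring
  have cone₁ : ∀ s, √(γ s 1 + p ^ 2) * Real.cos (globalTime M J (γ s 0) (γ s 2)
      - globalTime M J (inputOne θ x).pastTip.1 (inputOne θ x).pastTip.2) ≤
      √(γ s 1 + q ^ 2) * Real.cos (globalAngle M J (γ s 0) (γ s 2)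
      - globalAngle M J (inputOne θ x).pastTip.1 (inputOne θ x).pastTip.2) ↔
      a * Real.exp s * q₁ ≤ b * Real.exp (-s) * n := fun s => by
    rw [T1, A1, hTe, hAe,
      show p * (θ / 2) + q * (θ / 2) - (p * (θ / 2 - x) - q * (θ / 2)) = p * x + q * θ by ring,
      show p * (θ / 2) - q * (θ / 2) - (p * (θ / 2 - x) - q * (θ / 2)) = p * x by ring,
      show p * (θ / 2) + q * (θ / 2) - (-p * (θ / 2) + q * (θ / 2 - x)) = p * θ + q * x by ring,
      show -p * (θ / 2) + q * (θ / 2) - (-p * (θ / 2) + q * (θ / 2 - x)) = q * x by ring]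
    have h1 : Real.cos (p * x + q * θ) = Real.cos (p * θ + q * x) + 2 * q₁ := by linarith
    have h2 : Real.cos (q * x) = Real.cos (p * x) + 2 * n := by linarith
    rw [h1, h2]
    constructor <;> intro h <;> linarith
  have cone₂ : ∀ s, √(γ s 1 + p ^ 2) * Real.cos (globalTime M J (γ s 0) (γ s 2)
      - globalTime M J (inputTwo θ x).pastTip.1 (inputTwo θ x).pastTip.2) ≤
      √(γ s 1 + q ^ 2) * Real.cos (globalAngle M J (γ s 0) (γ s 2)
      - globalAngle M J (inputTwo θ x).pastTip.1 (inputTwo θ x).pastTip.2) ↔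
      b * Real.exp (-s) * q₂ ≤ a * Real.exp s * n := fun s => by
    rw [T2, A2, hTe, hAe,
      show p * (θ / 2) + q * (θ / 2) - (p * (θ / 2 - x) + q * (θ / 2)) = p * x by ring,
      show p * (θ / 2) - q * (θ / 2) - (p * (θ / 2 - x) + q * (θ / 2)) = p * x - q * θ by ring,
      show p * (θ / 2) + q * (θ / 2) - (p * (θ / 2) + q * (θ / 2 - x)) = q * x by ring,
      show -p * (θ / 2) + q * (θ / 2) - (p * (θ / 2) + q * (θ / 2 - x)) = -p * θ + q * x by ring]
    have h1 : Real.cos (p * x - q * θ) = Real.cos (-p * θ + q * x) + 2 * q₂ := by linarith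
    have h2 : Real.cos (q * x) = Real.cos (p * x) + 2 * n := by linarith
    rw [h1, h2]
    constructor <;> intro h <;> linarith
  -- From `b₊ + |b₋| ≤ 1`. With `x < θ < π` it bounds every global coordinate difference between `γ`
  -- and the tips as the causal lemmas require.
  have hqθ : |q| * θ ≤ (1 - p) * θ := by
    refine mul_le_mul_of_nonneg_right ?_ (by linarith)
    rw [abs_le]; constructor <;> linarith
  have hqθ1 : q * θ ≤ |q| * θ := mul_le_mul_of_nonneg_right (le_abs_self q) (by linarith)
  have hqθ2 : -(|q| * θ) ≤ q * θ := by
    rw [← neg_mul]; exact mul_le_mul_of_nonneg_right (neg_abs_le q) (by linarith)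
  have hpx : p * x < p * θ := mul_lt_mul_of_pos_left hxθ hb0
  have hpx0 : 0 < p * x := mul_pos hb0 hx
  have hqx : |q| * x ≤ |q| * θ := mul_le_mul_of_nonneg_left hxθ.le (abs_nonneg q)
  have hqx1 : q * x ≤ |q| * x := mul_le_mul_of_nonneg_right (le_abs_self q) hx.le
  have hqx2 : -(|q| * x) ≤ q * x := by
    rw [← neg_mul]; exact mul_le_mul_of_nonneg_right (neg_abs_le q) hx.le
  have bT₁ : ∀ s, globalTime M J (γ s 0) (γ s 2)
      - globalTime M J (inputOne θ x).pastTip.1 (inputOne θ x).pastTip.2 ≤ Real.pi := fun s => by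
    rw [T1]
    rcases Set.mem_uIcc.1 (hTu s) with h | h <;> linarith [h.2]
  have bT₂ : ∀ s, globalTime M J (γ s 0) (γ s 2)
      - globalTime M J (inputTwo θ x).pastTip.1 (inputTwo θ x).pastTip.2 ≤ Real.pi := fun s => by
    rw [T2]
    rcases Set.mem_uIcc.1 (hTu s) with h | h <;> linarith [h.2]
  have bA₁ : ∀ s, |globalAngle M J (γ s 0) (γ s 2)
      - globalAngle M J (inputOne θ x).pastTip.1 (inputOne θ x).pastTip.2| < Real.pi := fun s => by
    rw [A1, abs_lt]
    rcases Set.mem_uIcc.1 (hAu s) with h | h <;> constructor <;> linarith [h.1, h.2]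
  have bA₂ : ∀ s, |globalAngle M J (γ s 0) (γ s 2)
      - globalAngle M J (inputTwo θ x).pastTip.1 (inputTwo θ x).pastTip.2| < Real.pi := fun s => by
    rw [A2, abs_lt]
    rcases Set.mem_uIcc.1 (hAu s) with h | h <;> constructor <;> linarith [h.1, h.2]
  have mem₁ : ∀ s, γ s ∈ causalFuture M J (inputOne θ x).pastTip ↔
      a * Real.exp s * q₁ ≤ b * Real.exp (-s) * n := fun s => by
    refine ⟨fun h => (cone₁ s).1
      (light_cone_le_of_mem_causalFuture hM0 hJ (hγ.1.2.1 s) h (bT₁ s)), fun h => ?_⟩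
    -- The condition for `c₁` persists towards the end `b₁` of `γ`, where the global time exceeds
    -- that of `c₁` by `b₊ x > 0`. For `c₂` the other end plays this role.
    refine hγ.mem_causalFuture hM0 hJ bT₁ bA₁ (S := Set.Iic s) isPreconnected_Iic
      (fun y hy => (cone₁ y).2 ?_) ?_ (Set.mem_Iic.2 le_rfl)
    · have hy' : y ≤ s := hy
      calc a * Real.exp y * q₁ ≤ a * Real.exp s * q₁ := by gcongr
        _ ≤ b * Real.exp (-s) * n := h
        _ ≤ b * Real.exp (-y) * n := by gcongr
    · have hev := (limP.sub_const (globalTime M J (inputOne θ x).pastTip.1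
        (inputOne θ x).pastTip.2)).eventually_const_lt (u := 0) (by rw [T1]; linarith)
      obtain ⟨y, hy, hys⟩ := (hev.and (eventually_le_atBot s)).exists
      exact ⟨y, hys, hy⟩
  have mem₂ : ∀ s, γ s ∈ causalFuture M J (inputTwo θ x).pastTip ↔
      b * Real.exp (-s) * q₂ ≤ a * Real.exp s * n := fun s => by
    refine ⟨fun h => (cone₂ s).1
      (light_cone_le_of_mem_causalFuture hM0 hJ (hγ.1.2.1 s) h (bT₂ s)), fun h => ?_⟩
    refine hγ.mem_causalFuture hM0 hJ bT₂ bA₂ (S := Set.Ici s) isPreconnected_Ici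
      (fun y hy => (cone₂ y).2 ?_) ?_ (Set.mem_Ici.2 le_rfl)
    · have hy' : s ≤ y := hy
      calc b * Real.exp (-y) * q₂ ≤ b * Real.exp (-s) * q₂ := by gcongr
        _ ≤ a * Real.exp s * n := h
        _ ≤ a * Real.exp y * n := by gcongr
    · have hev := (limQ.sub_const (globalTime M J (inputTwo θ x).pastTip.1
        (inputTwo θ x).pastTip.2)).eventually_const_lt (u := 0) (by rw [T2]; linarith)
      obtain ⟨y, hy, hys⟩ := (hev.and (eventually_ge_atTop s)).exists
      exact ⟨y, hys, hy⟩
  rw [scatteringRegion_nonempty_iff hγ.1.2.1]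
  simp only [mem₁, mem₂]
  rw [exists_exp_bounds_iff ha hb hn0 hq₁0 hq₂0,
    sineCondition_iff (sin_mul_pos hm hm1 (by linarith) (by linarith)).ne'
      (sin_mul_pos hp hp1 (by linarith) (by linarith)).ne']
  rw [hq₁, hq₂, hn]
  constructor <;> intro h <;> linarith

lemma lengths_iff (hM0 : M < 0) (hJ : |J| < |M|) (hJ1 : |J| ≤ 1 - |M|) {θ x : ℝ}
    (hx : 0 < x) (hxθ : x < θ) (hθ : θ < Real.pi) (h : θ + x < Real.pi / bPlus M J) :
    ∃ Lout Lin L₁ L₂ : ℝ,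
      IsExtremalLength M J (inputOne θ x).left (inputTwo θ x).right Lout ∧
      IsExtremalLength M J (inputOne θ x).right (inputTwo θ x).left Lin ∧
      IsExtremalLength M J (inputOne θ x).left (inputOne θ x).right L₁ ∧
      IsExtremalLength M J (inputTwo θ x).left (inputTwo θ x).right L₂ ∧
      (Lout + Lin ≤ L₁ + L₂ ↔ SineCondition M J θ x) := by
  have hp := bPlus_add_bMinus_pos hJ
  have hm := bPlus_sub_bMinus_pos hJ
  have hp1 := bPlus_add_bMinus_le_one hJ hJ1
  have hm1 := bPlus_sub_bMinus_le_one hJ hJ1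
  have hb0 := bPlus_pos hJ
  rw [lt_div_iff₀ hb0, mul_comm] at h
  have hw : ∀ y, y ≤ θ + x → bPlus M J * y < Real.pi := fun y hy =>
    (mul_le_mul_of_nonneg_left hy hb0.le).trans_lt h
  have hs : ∀ y, 0 < y → y ≤ θ + x → 0 < Real.sin ((bPlus M J + bMinus M J) / 2 * y)
      * Real.sin ((bPlus M J - bMinus M J) / 2 * y) := fun y hy hy' =>
    mul_pos (sin_mul_pos hp hp1 hy (by linarith)) (sin_mul_pos hm hm1 hy (by linarith))
  refine ⟨_, _, _, _,
    isExtremalLength hM0 hJ (δ := θ + x) (by linarith) (hw _ le_rfl) rfl ?_,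
    isExtremalLength hM0 hJ (δ := θ - x) (by linarith) (hw _ (by linarith)) rfl ?_,
    isExtremalLength hM0 hJ (δ := x) hx (hw _ (by linarith)) rfl ?_,
    isExtremalLength hM0 hJ (δ := x) hx (hw _ (by linarith)) rfl ?_, ?_⟩
  · simp only [inputOne, inputTwo, BdyInterval.left, BdyInterval.right]; ring
  · simp only [inputOne, inputTwo, BdyInterval.left, BdyInterval.right]; ring
  · simp only [inputOne, BdyInterval.left, BdyInterval.right]; ring
  · simp only [inputTwo, BdyInterval.left, BdyInterval.right]; ring
  · rw [lengths_le_iff (hs _ (by linarith) le_rfl) (hs _ (by linarith) (by linarith))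
      (hs _ hx (by linarith)),
      sineCondition_iff (sin_mul_pos hm hm1 (by linarith) (by linarith)).ne'
      (sin_mul_pos hp hp1 (by linarith) (by linarith)).ne']

lemma exists_isExtremalCurve_futureTip (hM0 : M < 0) (hJ : |J| < |M|) (hJ1 : |J| ≤ 1 - |M|)
    {θ x : ℝ} (hx : 0 < x) (hxθ : x < θ) (hθ : θ < Real.pi) :
    ∃ γ, IsExtremalCurve M J (inputOne θ x).futureTip (inputTwo θ x).futureTip γ := by
  have hp1 := bPlus_add_bMinus_le_one hJ hJ1
  have hm1 := bPlus_sub_bMinus_le_one hJ hJ1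
  have e : (inputTwo θ x).futureTip =
      ((inputOne θ x).futureTip.1, (inputOne θ x).futureTip.2 + θ) := by
    simp only [inputOne, inputTwo, BdyInterval.futureTip, Prod.mk.injEq, true_and]; ring
  rw [e]
  exact exists_isExtremalCurve hM0 hJ _ _ (hx.trans hxθ) (by nlinarith)

end SpinningDefect

end

/-- In the first part `Lout + Lin` and `L₁ + L₂` are the lengths of the candidates `u` and `d`; in
the second part `γ` is the extremal surface of the output region between the two inputs, whose
corners are the future-most points of the input regions. -/
theorem mainTheorem6 (M J θ x : ℝ) (hM : -1 < M) (hM0 : M < 0)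
    (hJ : |J| < |M|) (hJ1 : |J| ≤ 1 - |M|)
    (hx : 0 < x) (hxθ : x < θ) (hθ : θ < Real.pi) :
    (θ + x < Real.pi / SpinningDefect.bPlus M J →
      ∃ Lout Lin L₁ L₂ : ℝ,
        SpinningDefect.IsExtremalLength M J (SpinningDefect.inputOne θ x).left
          (SpinningDefect.inputTwo θ x).right Lout ∧
        SpinningDefect.IsExtremalLength M J (SpinningDefect.inputOne θ x).right
          (SpinningDefect.inputTwo θ x).left Lin ∧
        SpinningDefect.IsExtremalLength M J (SpinningDefect.inputOne θ x).left
          (SpinningDefect.inputOne θ x).right L₁ ∧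
        SpinningDefect.IsExtremalLength M J (SpinningDefect.inputTwo θ x).left
          (SpinningDefect.inputTwo θ x).right L₂ ∧
        (Lout + Lin ≤ L₁ + L₂ ↔ SpinningDefect.SineCondition M J θ x)) ∧
    (∃ γ, SpinningDefect.IsExtremalCurve M J (SpinningDefect.inputOne θ x).futureTip
      (SpinningDefect.inputTwo θ x).futureTip γ) ∧
    ∀ γ, SpinningDefect.IsExtremalCurve M J (SpinningDefect.inputOne θ x).futureTip
        (SpinningDefect.inputTwo θ x).futureTip γ →
      ((SpinningDefect.scatteringRegion M J (SpinningDefect.inputOne θ x).pastTip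
          (SpinningDefect.inputTwo θ x).pastTip γ).Nonempty ↔
        SpinningDefect.SineCondition M J θ x) := by
  exact ⟨SpinningDefect.lengths_iff hM0 hJ hJ1 hx hxθ hθ,
    SpinningDefect.exists_isExtremalCurve_futureTip hM0 hJ hJ1 hx hxθ hθ,
    fun _ hγ => SpinningDefect.scattering_iff hM0 hJ hJ1 hx hxθ hθ hγ⟩
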